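/- Let $\widehat{\mathbb C}=\mathbb C\cup\{\infty\}$, let $\mathbb D$ be the open unit disk and $\mathbb D^*:=\widehat{\mathbb C}\setminus\overline{\mathbb D}$. Let $r$ be a rational map of degree $k\ge 1$ with $|r(\infty)|>1$ (where $r(\infty)=\infty$ is allowed). Then the rational lemniscate $L_r:=\{z\in\widehat{\mathbb C}:|r(z)|=1\}$ is an analytic Jordan curve (the image of the unit circle under an injective holomorphic map defined on a neighborhood of the circle) if and only if the following two conditions hold. (i) $r$ has precisely $k-1$ critical values in $\mathbb D$ and precisely $k-1$ critical values in $\mathbb D^*$, counting multiplicities; that is, $\sum_{z\in\widehat{\mathbb C},\ r(z)\in\mathbb D}(e_r(z)-1)=k-1$ and $\sum_{z\in\widehat{\mathbb C},\ r(z)\in\mathbb D^*}(e_r(z)-1)=k-1$, where $e_r(z)$ is the local degree of $r$ at $z$. (ii) There exists a Jordan curve $\Gamma$ in $\mathbb C$ whose interior (the bounded component of its complement) contains all the zeros of $r$ in $\widehat{\mathbb C}$ and whose exterior (the component of $\widehat{\mathbb C}\setminus\Gamma$ containing $\infty$) contains all the poles of $r$ in $\widehat{\mathbb C}$, such that $|r(z)|\le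 1$ for all $z\in\Gamma$. -/

import Mathlib

noncomputable section

namespace RationalLemniscate

open Polynomial

/-- The degree of a rational map `r = p / q` in lowest terms: `max (deg p) (deg q)`. -/
def degree (r : RatFunc ℂ) : ℕ := max r.num.natDegree r.denom.natDegree

/-- The rational function `r` as a map from the Riemann sphere to itself. Poles are sent to `∞`,
and the value at `∞` is the limit of `r` there (recall that `r.denom` is monic). -/
def toSphere (r : RatFunc ℂ) (z : OnePoint ℂ) : OnePoint ℂ :=
  z.elim
    (if r.denom.natDegree < r.num.natDegree then OnePoint.infty
      else ((r.num.coeff r.denom.natDegree : ℂ) : OnePoint ℂ))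
    (fun z => if r.denom.eval z = 0 then OnePoint.infty
      else ((r.num.eval z / r.denom.eval z : ℂ) : OnePoint ℂ))

/-- The open unit disk, as a subset of the Riemann sphere. -/
def disk : Set (OnePoint ℂ) := (↑) '' Metric.ball (0 : ℂ) 1

/-- The closed unit disk, as a subset of the Riemann sphere. -/
def closedDisk : Set (OnePoint ℂ) := (↑) '' Metric.closedBall (0 : ℂ) 1

/-- The unit circle, as a subset of the Riemann sphere. -/
def unitCircle : Set (OnePoint ℂ) := (↑) '' Metric.sphere (0 : ℂ) 1

/-- The complement of the closed unit disk in the Riemann sphere; it contains `∞`. -/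
def diskStar : Set (OnePoint ℂ) := closedDiskᶜ

/-- The rational lemniscate `{z : |r z| = 1}` in the Riemann sphere. -/
def lemniscate (r : RatFunc ℂ) : Set (OnePoint ℂ) := {z | toSphere r z ∈ unitCircle}

/-- With `r = p / q` in lowest terms, the polynomial whose finite zeros are the finite solutions
of `r z = w`, with multiplicities: `p - w q` if `w` is finite, and `q` if `w = ∞`. -/
def fiberPoly (r : RatFunc ℂ) (w : OnePoint ℂ) : ℂ[X] :=
  w.elim r.denom (fun w => r.num - C w * r.denom)

/-- The local degree of `r` at `z`, that is, the multiplicity of `z` as a solution of the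
equation `r = r z`. The multiplicity of the solution `∞` is the number of solutions
(namely `degree r`) that are missing in the finite plane. -/
def localDegree (r : RatFunc ℂ) (z : OnePoint ℂ) : ℕ :=
  z.elim (degree r - (fiberPoly r (toSphere r OnePoint.infty)).natDegree)
    (fun a => (fiberPoly r (toSphere r (a : OnePoint ℂ))).rootMultiplicity a)

/-- The multiplicity of `z` as a critical point of `r` (it is `0` if `z` is not critical). -/
def criticalMultiplicity (r : RatFunc ℂ) (z : OnePoint ℂ) : ℕ := localDegree r z - 1

/-- The number of critical values of `r` in `A`, counting multiplicities: each critical point `z`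
with `r z ∈ A` contributes its multiplicity. The sum is finite for nonconstant `r`,
see `finite_criticalPoints`. -/
def criticalValueCount (r : RatFunc ℂ) (A : Set (OnePoint ℂ)) : ℕ :=
  ∑ᶠ z ∈ toSphere r ⁻¹' A, criticalMultiplicity r z

/-- A Jordan curve in the plane: a homeomorphic image of the circle. -/
def IsJordanCurve (Γ : Set ℂ) : Prop :=
  ∃ γ : Circle → ℂ, Continuous γ ∧ Function.Injective γ ∧ Set.range γ = Γ

/-- An analytic Jordan curve in the plane: the image of the unit circle under an injective
holomorphic map defined on a neighborhood of the circle. -/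
def IsAnalyticJordanCurve (Γ : Set ℂ) : Prop :=
  ∃ (f : ℂ → ℂ) (U : Set ℂ), IsOpen U ∧ Metric.sphere (0 : ℂ) 1 ⊆ U ∧
    DifferentiableOn ℂ f U ∧ Set.InjOn f U ∧ f '' Metric.sphere (0 : ℂ) 1 = Γ

/-- The interior of a Jordan curve `Γ`: the bounded component of its complement. -/
def inside (Γ : Set ℂ) : Set ℂ :=
  {z | z ∈ Γᶜ ∧ Bornology.IsBounded (connectedComponentIn Γᶜ z)}

/-- The exterior of a Jordan curve `Γ`: the component of its complement in the Riemann sphere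
that contains `∞`. -/
def outside (Γ : Set ℂ) : Set (OnePoint ℂ) :=
  connectedComponentIn (((↑) : ℂ → OnePoint ℂ) '' Γ)ᶜ OnePoint.infty

theorem wronskian_num_denom_ne_zero (r : RatFunc ℂ) (hr : 1 ≤ degree r) :
    wronskian r.num r.denom ≠ 0 := by
  intro h
  obtain ⟨h1, h2⟩ := (RatFunc.isCoprime_num_denom r).wronskian_eq_zero_iff.mp h
  have h3 := derivative_eq_zero.mp h1
  have h4 := derivative_eq_zero.mp h2
  simp [degree, h3, h4] at hr

/-- A nonconstant rational map has finitely many critical points. -/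
theorem finite_criticalPoints (r : RatFunc ℂ) (hr : 1 ≤ degree r) :
    {z | criticalMultiplicity r z ≠ 0}.Finite := by
  have hW := wronskian_num_denom_ne_zero r hr
  refine (((wronskian r.num r.denom).roots.toFinset.finite_toSet.image
    ((↑) : ℂ → OnePoint ℂ)).insert OnePoint.infty).subset ?_
  intro z hz
  induction z using OnePoint.rec with
  | infty => exact Set.mem_insert _ _
  | coe a =>
    refine Set.mem_insert_of_mem _ ⟨a, ?_, rfl⟩
    have h2 : 1 < (fiberPoly r (toSphere r (a : OnePoint ℂ))).rootMultiplicity a := by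
      have h : (fiberPoly r (toSphere r (a : OnePoint ℂ))).rootMultiplicity a - 1 ≠ 0 := hz
      omega
    generalize toSphere r (a : OnePoint ℂ) = w at h2
    have hp : fiberPoly r w ≠ 0 := by
      intro h0
      simp [h0] at h2
    obtain ⟨h3, h4⟩ := (one_lt_rootMultiplicity_iff_isRoot hp).mp h2
    simp only [Finset.mem_coe, Multiset.mem_toFinset, mem_roots hW]
    induction w using OnePoint.rec with
    | infty =>
      simp only [fiberPoly, OnePoint.elim_infty, IsRoot.def] at h3 h4
      simp [wronskian, h3, h4]
    | coe w =>
      simp only [fiberPoly, OnePoint.elim_some, IsRoot.def, eval_sub, eval_mul, eval_C,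
        derivative_sub, derivative_C_mul] at h3 h4
      simp only [wronskian, IsRoot.def, eval_sub, eval_mul]
      linear_combination eval a (derivative r.denom) * h3 - eval a r.denom * h4

end RationalLemniscate

end

/-! Write `r = p / q` in lowest terms. The finite critical points are the zeros of the Wronskian `W
= p q' - p' q`. If none of them lies on the lemniscate `L`, then `r` is a covering over a thin
annulus around the unit circle. Hence `L` is a disjoint union of `n` analytic Jordan curves, each
with a coordinate `f` in which `r ∘ f` is `z ^ d` (`exists_decomposition`).

The core is a Riemann–Hurwitz count for `{|r| < 1}` made with winding numbers only, without the
Jordan curve theorem. For an embedding `f` of an annulus, the quotient `(f z - f w) / (z - w)` has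
along the unit circle a winding number `ν` independent of `w`, and `f'` has winding number `2ν`
(Hopf's torus argument). So the `i`-th curve winds `ν i + 1` times around nearby points with `|r| <
1` and `ν i` times around nearby points with `|r| > 1`. Since all indices vanish near infinity, the
sum of the indices is the indicator function of `{|r| < 1}` (`sum_index`). The argument principle
for `p ∘ f = z ^ d * (q ∘ f)` and for its derivative, summed over the curves, shows that `{|r| < 1}`
contains `k - n - 2 ∑ ν i` critical points (`card_roots_wronskian`). The whole sphere has `2k - 2`
of them (`criticalValueCount_add`).

If `L` is an analytic Jordan curve, it carries no critical point: straightening both `L` and the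
unit circle turns `r` into a holomorphic function that is real exactly on the real line, and such a
function is locally injective. Then `n = 1` and `ν = 0`, so both counts are `k - 1`, and `Γ = L`
separates zeros from poles.

Conversely, (i) uses up all `2k - 2` critical points, so none is on `L`. By the maximum principle
`Γ` and the components of its complement that contain zeros lie in `{|r| ≤ 1}`, so all zeros lie in
one connected part of that set. Each curve borders a component of `{|r| < 1}`, which contains a
zero; hence around any zero every curve has index `ν i + 1`, and `∑ (ν i + 1) = 1`. The count
becomes `k - 1 = k - 2 + n`, that is, `n = 1`. -/

noncomputable section

namespace RationalLemniscate

open Polynomial Filter Topology Metric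

/-! ### Winding numbers through continuous logarithms -/

/-- `g` is a loop (of period `2π`) in `ℂ \ {0}` with winding number `n` about `0`. -/
def HasWinding (g : ℝ → ℂ) (n : ℤ) : Prop :=
  ∃ Λ : ℝ → ℂ, Continuous Λ ∧ (∀ t, Complex.exp (Λ t) = g t) ∧
    ∀ t, Λ (t + 2 * Real.pi) = Λ t + n * (2 * Real.pi * Complex.I)

/-- A continuous function to `ℂ \ {0}` on a real normed space has a continuous logarithm. -/
theorem exists_continuous_log {E : Type*} [NormedAddCommGroup E] [NormedSpace ℝ E] {g : E → ℂ}
    (hg : Continuous g) (h0 : ∀ x, g x ≠ 0) :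
    ∃ Λ : E → ℂ, Continuous Λ ∧ ∀ x, Complex.exp (Λ x) = g x := by
  have hs : IsSimplyConnected (Set.univ : Set E) := by
    have := convex_univ.contractibleSpace (Set.univ_nonempty (α := E))
    exact SimplyConnectedSpace.ofContractible _
  obtain ⟨Λ, h1, h2⟩ := Complex.exists_continuousOn_eqOn_exp_comp hs isOpen_univ
    hg.continuousOn (by simpa using h0)
  exact ⟨Λ, continuousOn_univ.mp h1, fun x => h2 (Set.mem_univ x)⟩

/-- Two continuous logarithms of the same function on a connected space differ by a constant. -/
theorem exists_int_of_exp_eq {E : Type*} [TopologicalSpace E] [PreconnectedSpace E]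
    {Λ₁ Λ₂ : E → ℂ} (h1 : Continuous Λ₁) (h2 : Continuous Λ₂)
    (h : ∀ x, Complex.exp (Λ₁ x) = Complex.exp (Λ₂ x)) :
    ∃ n : ℤ, ∀ x, Λ₁ x = Λ₂ x + n * (2 * Real.pi * Complex.I) := by
  rcases isEmpty_or_nonempty E with hE | ⟨⟨x₀⟩⟩
  · exact ⟨0, fun x => (hE.false x).elim⟩
  choose n hn using fun x => Complex.exp_eq_exp_iff_exists_int.mp (h x)
  have hpi : (2 * Real.pi * Complex.I : ℂ) ≠ 0 := Complex.two_pi_I_ne_zero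
  have hc : Continuous fun x => ((n x : ℤ) : ℂ) := by
    have : (fun x => ((n x : ℤ) : ℂ)) = fun x => (Λ₁ x - Λ₂ x) / (2 * Real.pi * Complex.I) := by
      funext x
      rw [hn x]
      field_simp
      ring
    rw [this]
    fun_prop
  have hc' : Continuous n :=
    (Int.isClosedEmbedding_coe_real.isEmbedding.continuous_iff).mpr (by
      have := Complex.continuous_re.comp hc
      exact this.congr fun x => by simp)
  refine ⟨n x₀, fun x => ?_⟩
  rw [hn x, PreconnectedSpace.constant inferInstance hc' (x := x) (y := x₀)]

namespace HasWinding

variable {g g' : ℝ → ℂ} {n n' : ℤ}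

theorem exists_of_continuous (hg : Continuous g) (h0 : ∀ t, g t ≠ 0)
    (hp : ∀ t, g (t + 2 * Real.pi) = g t) : ∃ n, HasWinding g n := by
  obtain ⟨Λ, h1, h2⟩ := exists_continuous_log hg h0
  obtain ⟨n, hn⟩ := exists_int_of_exp_eq (Λ₁ := fun t => Λ (t + 2 * Real.pi)) (Λ₂ := Λ)
    (by fun_prop) h1 (fun t => by rw [h2, h2, hp])
  exact ⟨n, Λ, h1, h2, hn⟩

theorem unique (h : HasWinding g n) (h' : HasWinding g n') : n = n' := by
  obtain ⟨Λ, h1, h2, h3⟩ := h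
  obtain ⟨Λ', h1', h2', h3'⟩ := h'
  obtain ⟨m, hm⟩ := exists_int_of_exp_eq h1 h1' (fun t => by rw [h2, h2'])
  have e1 := h3 0
  have e2 := h3' 0
  rw [hm, hm, e2] at e1
  have hpi : (2 * Real.pi * Complex.I : ℂ) ≠ 0 := Complex.two_pi_I_ne_zero
  have : (n' : ℂ) * (2 * Real.pi * Complex.I) = n * (2 * Real.pi * Complex.I) := by
    linear_combination e1
  exact_mod_cast (mul_right_cancel₀ hpi this).symm

theorem ne_zero (h : HasWinding g n) (t : ℝ) : g t ≠ 0 := by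
  obtain ⟨Λ, -, h2, -⟩ := h
  rw [← h2]
  exact Complex.exp_ne_zero _

theorem mul (h : HasWinding g n) (h' : HasWinding g' n') :
    HasWinding (fun t => g t * g' t) (n + n') := by
  obtain ⟨Λ, h1, h2, h3⟩ := h
  obtain ⟨Λ', h1', h2', h3'⟩ := h'
  refine ⟨fun t => Λ t + Λ' t, by fun_prop, fun t => by rw [Complex.exp_add, h2, h2'], fun t => ?_⟩
  simp only [h3, h3']
  push_cast
  ring

theorem const {c : ℂ} (hc : c ≠ 0) : HasWinding (fun _ => c) 0 :=
  ⟨fun _ => Complex.log c, continuous_const, fun _ => Complex.exp_log hc, fun _ => by simp⟩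

theorem pow (h : HasWinding g n) (m : ℕ) : HasWinding (fun t => g t ^ m) (m * n) := by
  obtain ⟨Λ, h1, h2, h3⟩ := h
  refine ⟨fun t => m * Λ t, by fun_prop, fun t => by rw [Complex.exp_nat_mul, h2], fun t => ?_⟩
  simp only [h3]
  push_cast
  ring

theorem multiset_prod {α : Type*} (s : Multiset α) {g : α → ℝ → ℂ} {n : α → ℤ}
    (h : ∀ a ∈ s, HasWinding (g a) (n a)) :
    HasWinding (fun t => (s.map fun a => g a t).prod) (s.map n).sum := by
  induction s using Multiset.induction_on with
  | empty => simpa using const one_ne_zero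
  | cons a s ih =>
    simpa using (h a (by simp)).mul (ih fun b hb => h b (by simp [hb]))

/-- Rouché: winding numbers are stable under small perturbations. -/
theorem of_norm_sub_lt (h : HasWinding g n) (hg : Continuous g')
    (hp : ∀ t, g' (t + 2 * Real.pi) = g' t) (hlt : ∀ t, ‖g' t - g t‖ < ‖g t‖) :
    HasWinding g' n := by
  have h0 := h.ne_zero
  obtain ⟨Λ, h1, h2, h3⟩ := h
  have hgc : Continuous g := by
    have : g = fun t => Complex.exp (Λ t) := funext fun t => (h2 t).symm
    rw [this]
    fun_prop
  have hgp : ∀ t, g (t + 2 * Real.pi) = g t := by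
    intro t
    rw [← h2, h3, ← h2, Complex.exp_add, Complex.exp_int_mul_two_pi_mul_I, mul_one]
  -- The quotient stays in the disk of radius 1 about 1, so its principal logarithm is a continuous
  -- periodic correction to the lift of `g`.
  have hs : ∀ t, g' t / g t ∈ Complex.slitPlane := by
    intro t
    have : g' t / g t = 1 + (g' t - g t) / g t := by
      field_simp [h0 t]
      ring
    rw [this]
    apply Complex.mem_slitPlane_of_norm_lt_one
    rw [norm_div]
    exact (div_lt_one (norm_pos_iff.mpr (h0 t))).mpr (hlt t)
  refine ⟨fun t => Λ t + Complex.log (g' t / g t), ?_, fun t => ?_, fun t => ?_⟩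
  · exact h1.add ((hg.div hgc h0).clog hs)
  · rw [Complex.exp_add, h2, Complex.exp_log (Complex.slitPlane_ne_zero (hs t)),
      mul_div_cancel₀ _ (h0 t)]
  · simp only [h3, hp, hgp]
    ring

/-- Compactness of one period makes the perturbation uniformly small, so Rouché applies; periodicity
carries the bound to all `t`. -/
theorem eventually {X : Type*} [TopologicalSpace X] {H : X → ℝ → ℂ}
    (hc : Continuous fun x : X × ℝ => H x.1 x.2) (hp : ∀ x t, H x (t + 2 * Real.pi) = H x t)
    {x₀ : X} (h : HasWinding (H x₀) n) : ∀ᶠ x in 𝓝 x₀, HasWinding (H x) n := by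
  have key : ∀ᶠ x in 𝓝 x₀, ∀ t ∈ Set.Icc (0 : ℝ) (2 * Real.pi),
      ‖H x t - H x₀ t‖ < ‖H x₀ t‖ := by
    refine isCompact_Icc.eventually_forall_of_forall_eventually fun t _ => ?_
    have h1 : Continuous fun x : X × ℝ => ‖H x.1 x.2 - H x₀ x.2‖ :=
      (hc.sub (hc.comp (by fun_prop : Continuous fun x : X × ℝ => (x₀, x.2)))).norm
    have h2 : Continuous fun x : X × ℝ => ‖H x₀ x.2‖ :=
      (hc.comp (by fun_prop : Continuous fun x : X × ℝ => (x₀, x.2))).norm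
    refine (h1.continuousAt (x := (x₀, t))).eventually_lt h2.continuousAt ?_
    simpa using h.ne_zero t
  filter_upwards [key] with x hx
  refine h.of_norm_sub_lt (hc.comp (by fun_prop : Continuous fun t : ℝ => (x, t))) (hp x)
    fun t => ?_
  have hper : ∀ y, Function.Periodic (H y) (2 * Real.pi) := hp
  set u := toIcoMod Real.two_pi_pos 0 t
  have hu : u ∈ Set.Icc (0 : ℝ) (2 * Real.pi) := by
    have := toIcoMod_mem_Ico Real.two_pi_pos 0 t
    exact ⟨this.1, by linarith [this.2]⟩
  have hsub : ∀ y, H y u = H y t := fun y => by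
    have : u = t - toIcoDiv Real.two_pi_pos 0 t • (2 * Real.pi) := rfl
    rw [this]
    exact (hper y).sub_zsmul_eq _
  rw [← hsub, ← hsub]
  exact hx u hu

/-- Homotopy invariance: the winding number is locally constant in the parameter. -/
theorem of_preconnected {X : Type*} [TopologicalSpace X] [PreconnectedSpace X] {H : X → ℝ → ℂ}
    (hc : Continuous fun x : X × ℝ => H x.1 x.2) (hp : ∀ x t, H x (t + 2 * Real.pi) = H x t)
    (h0 : ∀ x t, H x t ≠ 0) {x₀ : X} (h : HasWinding (H x₀) n) (x : X) : HasWinding (H x) n := by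
  choose m hm using fun x => exists_of_continuous (g := H x)
    (hc.comp (by fun_prop : Continuous fun t : ℝ => (x, t))) (h0 x) (hp x)
  have hloc : IsLocallyConstant m := by
    rw [IsLocallyConstant.iff_eventually_eq]
    intro y
    filter_upwards [(hm y).eventually hc hp] with z hz
    exact (hm z).unique hz
  rw [h.unique (hm x₀), ← hloc.apply_eq_of_isPreconnected isPreconnected_univ
    (Set.mem_univ x) (Set.mem_univ x₀)]
  exact hm x

/-- The winding number along the diagonal of a torus is the sum of the winding numbers along the
two factors. -/
theorem diagonal {K : ℝ → ℝ → ℂ} (hc : Continuous fun x : ℝ × ℝ => K x.1 x.2)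
    (hp : ∀ s t, K (s + 2 * Real.pi) t = K s t) (hp' : ∀ s t, K s (t + 2 * Real.pi) = K s t)
    (h1 : HasWinding (fun t => K t 0) n) (h2 : HasWinding (fun t => K 0 t) n')
    (h0 : ∀ s t, K s t ≠ 0) : HasWinding (fun t => K t t) (n + n') := by
  obtain ⟨Λ, hΛ, hexp⟩ := exists_continuous_log hc (fun x => h0 x.1 x.2)
  obtain ⟨m, hm⟩ := exists_int_of_exp_eq (Λ₁ := fun x : ℝ × ℝ => Λ (x.1 + 2 * Real.pi, x.2))
    (Λ₂ := Λ) (by fun_prop) hΛ (fun x => by rw [hexp, hexp]; exact hp _ _)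
  obtain ⟨m', hm'⟩ := exists_int_of_exp_eq (Λ₁ := fun x : ℝ × ℝ => Λ (x.1, x.2 + 2 * Real.pi))
    (Λ₂ := Λ) (by fun_prop) hΛ (fun x => by rw [hexp, hexp]; exact hp' _ _)
  have e1 : HasWinding (fun t => K t 0) m :=
    ⟨fun t => Λ (t, 0), by fun_prop, fun t => hexp (t, 0), fun t => hm (t, 0)⟩
  have e2 : HasWinding (fun t => K 0 t) m' :=
    ⟨fun t => Λ (0, t), by fun_prop, fun t => hexp (0, t), fun t => hm' (0, t)⟩
  rw [h1.unique e1, h2.unique e2]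
  refine ⟨fun t => Λ (t, t), by fun_prop, fun t => hexp (t, t), fun t => ?_⟩
  -- The diagonal period is a vertical period followed by a horizontal one.
  have a := hm (t, t + 2 * Real.pi)
  have b := hm' (t, t)
  simp only at a b ⊢
  rw [a, b]
  push_cast
  ring

theorem exp_mul_I : HasWinding (fun t => Complex.exp (t * Complex.I)) 1 :=
  ⟨fun t => t * Complex.I, by fun_prop, fun _ => rfl, fun t => by push_cast; ring⟩

end HasWinding

theorem exp_add_two_pi_mul_I (t : ℝ) :
    Complex.exp (((t + 2 * Real.pi : ℝ) : ℂ) * Complex.I) = Complex.exp (t * Complex.I) := by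
  push_cast
  rw [add_mul, Complex.exp_add, Complex.exp_two_pi_mul_I, mul_one]

theorem hasWinding_exp_sub_of_norm_lt {w : ℂ} (hw : ‖w‖ < 1) :
    HasWinding (fun t => Complex.exp (t * Complex.I) - w) 1 :=
  HasWinding.exp_mul_I.of_norm_sub_lt (by fun_prop)
    (fun t => by rw [exp_add_two_pi_mul_I])
    (fun t => by simpa [Complex.norm_exp_ofReal_mul_I] using hw)

theorem hasWinding_sub_of_norm_lt {g : ℝ → ℂ} (hg : Continuous g)
    (hp : ∀ t, g (t + 2 * Real.pi) = g t) {w : ℂ} (hw : ∀ t, ‖g t‖ < ‖w‖) :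
    HasWinding (fun t => g t - w) 0 :=
  (HasWinding.const (c := -w)
    (by simpa using ((norm_nonneg _).trans_lt (hw 0)))).of_norm_sub_lt (by fun_prop)
    (fun t => by rw [hp]) (fun t => by simpa using hw t)

/-! ### Annuli and the difference quotient of an embedding -/

/-- The open annulus `R⁻¹ < |z| < R`. -/
def annulus (R : ℝ) : Set ℂ := {z | R⁻¹ < ‖z‖ ∧ ‖z‖ < R}

/-- The standard parametrization of the unit circle. -/
def expCircle (t : ℝ) : ℂ := Complex.exp (t * Complex.I)

theorem continuous_expCircle : Continuous expCircle := by
  unfold expCircle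
  fun_prop

theorem norm_expCircle (t : ℝ) : ‖expCircle t‖ = 1 := Complex.norm_exp_ofReal_mul_I t

theorem expCircle_add (t : ℝ) : expCircle (t + 2 * Real.pi) = expCircle t :=
  exp_add_two_pi_mul_I t

theorem expCircle_mem_sphere (t : ℝ) : expCircle t ∈ sphere (0 : ℂ) 1 := by
  simp [norm_expCircle]

theorem isOpen_annulus (R : ℝ) : IsOpen (annulus R) :=
  (isOpen_lt continuous_const continuous_norm).inter (isOpen_lt continuous_norm continuous_const)

theorem mem_annulus_of_norm_eq_one {R : ℝ} (hR : 1 < R) {z : ℂ} (hz : ‖z‖ = 1) :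
    z ∈ annulus R :=
  ⟨by rw [hz]; exact inv_lt_one_of_one_lt₀ hR, by rw [hz]; exact hR⟩

theorem sphere_subset_annulus {R : ℝ} (hR : 1 < R) : sphere (0 : ℂ) 1 ⊆ annulus R :=
  fun _ hz => mem_annulus_of_norm_eq_one hR (mem_sphere_zero_iff_norm.mp hz)

theorem expCircle_mem_annulus {R : ℝ} (hR : 1 < R) (t : ℝ) : expCircle t ∈ annulus R :=
  mem_annulus_of_norm_eq_one hR (norm_expCircle t)

theorem ne_zero_of_mem_annulus {R : ℝ} (hR : 1 < R) {z : ℂ} (hz : z ∈ annulus R) : z ≠ 0 := by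
  rintro rfl
  have := hz.1
  rw [norm_zero] at this
  linarith [inv_pos.mpr (by linarith : (0 : ℝ) < R)]

/-- Round annuli are connected. -/
theorem isPreconnected_norm_mem_Ioo {a b : ℝ} (ha : 0 < a) (hb : 0 < b) :
    IsPreconnected {z : ℂ | a < ‖z‖ ∧ ‖z‖ < b} := by
  have hc : Convex ℝ {s : ℂ | Real.log a < s.re ∧ s.re < Real.log b} :=
    (convex_halfSpace_re_gt _).inter (convex_halfSpace_re_lt _)
  have : {z : ℂ | a < ‖z‖ ∧ ‖z‖ < b} =
      Complex.exp '' {s : ℂ | Real.log a < s.re ∧ s.re < Real.log b} := by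
    ext z
    constructor
    · rintro ⟨h1, h2⟩
      have hz : z ≠ 0 := norm_pos_iff.mp (ha.trans h1)
      refine ⟨Complex.log z, ⟨?_, ?_⟩, Complex.exp_log hz⟩
      · rw [Complex.log_re]
        exact Real.log_lt_log ha h1
      · rw [Complex.log_re]
        exact Real.log_lt_log (norm_pos_iff.mpr hz) h2
    · rintro ⟨s, ⟨h1, h2⟩, rfl⟩
      rw [Set.mem_ofPred_eq, Complex.norm_exp]
      exact ⟨(Real.log_lt_iff_lt_exp ha).mp h1, (Real.lt_log_iff_exp_lt hb).mp h2⟩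
  rw [this]
  exact hc.isPreconnected.image _ Complex.continuous_exp.continuousOn

theorem isPreconnected_annulus {R : ℝ} (hR : 1 < R) : IsPreconnected (annulus R) :=
  isPreconnected_norm_mem_Ioo (inv_pos.mpr (by linarith)) (by linarith)

/-- The difference quotient of a holomorphic function is jointly continuous. -/
theorem continuousOn_dslope_prod {f : ℂ → ℂ} {U : Set ℂ} (hU : IsOpen U)
    (hf : DifferentiableOn ℂ f U) :
    ContinuousOn (fun x : ℂ × ℂ => dslope f x.1 x.2) (U ×ˢ U) := by
  rintro ⟨a, b⟩ ⟨ha, hb⟩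
  apply ContinuousAt.continuousWithinAt
  have hUn : U ×ˢ U ∈ 𝓝 (a, b) := prod_mem_nhds (hU.mem_nhds ha) (hU.mem_nhds hb)
  rcases eq_or_ne b a with rfl | hab
  -- On the diagonal, strict differentiability controls the quotient while both points move; where
  -- the points coincide, continuity of the derivative does.
  · have hs : HasStrictDerivAt f (deriv f b) b :=
      (hf.analyticAt (hU.mem_nhds hb)).hasStrictDerivAt
    have hd : ContinuousAt (deriv f) b :=
      ((hf.analyticAt (hU.mem_nhds hb)).deriv).continuousAt
    rw [Metric.continuousAt_iff']
    intro ε hε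
    have h1 := (hs.hasStrictFDerivAt.isLittleO).def (half_pos hε)
    have h2 : ∀ᶠ x : ℂ × ℂ in 𝓝 (b, b), dist (deriv f x.1) (deriv f b) < ε :=
      (hd.comp (f := fun x : ℂ × ℂ => x.1) (x := (b, b)) continuous_fst.continuousAt).eventually
        (Metric.ball_mem_nhds _ hε)
    filter_upwards [h1, h2] with x hx1 hx2
    rcases eq_or_ne x.2 x.1 with h | h
    · simpa [h, dslope_same] using hx2
    · rw [dslope_of_ne _ h, dslope_same, slope_comm, slope_def_field, dist_eq_norm]
      have hne : x.1 - x.2 ≠ 0 := sub_ne_zero.mpr h.symm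
      have : (f x.1 - f x.2) / (x.1 - x.2) - deriv f b =
          (f x.1 - f x.2 - (x.1 - x.2) * deriv f b) / (x.1 - x.2) := by
        field_simp
      rw [this, norm_div, div_lt_iff₀ (norm_pos_iff.mpr hne)]
      have hx1' : ‖f x.1 - f x.2 - (x.1 - x.2) * deriv f b‖ ≤ ε / 2 * ‖x.1 - x.2‖ := by
        simpa using hx1
      have : 0 < ‖x.1 - x.2‖ := norm_pos_iff.mpr hne
      nlinarith
  · have hev : (fun x : ℂ × ℂ => dslope f x.1 x.2) =ᶠ[𝓝 (a, b)]
        fun x => (f x.2 - f x.1) / (x.2 - x.1) := by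
      have : ∀ᶠ x : ℂ × ℂ in 𝓝 (a, b), x.2 ≠ x.1 :=
        (isOpen_ne_fun continuous_snd continuous_fst).mem_nhds hab
      filter_upwards [this] with x hx
      rw [dslope_of_ne _ hx, slope_def_field]
    refine ContinuousAt.congr ?_ hev.symm
    have hca : ContinuousAt f a := (hf.differentiableAt (hU.mem_nhds ha)).continuousAt
    have hcb : ContinuousAt f b := (hf.differentiableAt (hU.mem_nhds hb)).continuousAt
    have h1 : ContinuousAt (fun x : ℂ × ℂ => f x.1) (a, b) :=
      ContinuousAt.comp (f := fun x : ℂ × ℂ => x.1) hca continuous_fst.continuousAt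
    have h2 : ContinuousAt (fun x : ℂ × ℂ => f x.2) (a, b) :=
      ContinuousAt.comp (f := fun x : ℂ × ℂ => x.2) hcb continuous_snd.continuousAt
    exact (h2.sub h1).div (continuous_snd.continuousAt.sub continuous_fst.continuousAt)
      (sub_ne_zero.mpr hab)

theorem dslope_ne_zero {f : ℂ → ℂ} {U : Set ℂ} (hinj : Set.InjOn f U)
    (hd : ∀ z ∈ U, deriv f z ≠ 0) {z w : ℂ} (hz : z ∈ U) (hw : w ∈ U) : dslope f z w ≠ 0 := by
  rcases eq_or_ne w z with rfl | h
  · rw [dslope_same]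
    exact hd _ hw
  · rw [dslope_of_ne _ h, slope_def_field]
    exact div_ne_zero (sub_ne_zero.mpr fun e => h (hinj hw hz e)) (sub_ne_zero.mpr h)

theorem dslope_comm (f : ℂ → ℂ) (z w : ℂ) : dslope f z w = dslope f w z := by
  rcases eq_or_ne w z with rfl | h
  · rfl
  · rw [dslope_of_ne _ h, dslope_of_ne _ h.symm, slope_comm]

section dslope

variable {f : ℂ → ℂ} {R : ℝ} (hR : 1 < R) (hf : DifferentiableOn ℂ f (annulus R))
  (hinj : Set.InjOn f (annulus R)) (hd : ∀ z ∈ annulus R, deriv f z ≠ 0)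

include hR hf hinj hd

/-- The base point moves through the connected annulus and the quotient never vanishes, so this is
homotopy invariance. -/
theorem hasWinding_dslope_of_hasWinding {ν : ℤ} {w₀ : ℂ} (hw₀ : w₀ ∈ annulus R)
    (hν : HasWinding (fun t => dslope f w₀ (expCircle t)) ν) {w : ℂ} (hw : w ∈ annulus R) :
    HasWinding (fun t => dslope f w (expCircle t)) ν := by
  have : PreconnectedSpace (annulus R) :=
    isPreconnected_iff_preconnectedSpace.mp (isPreconnected_annulus hR)
  have hc : Continuous fun x : annulus R × ℝ => dslope f x.1 (expCircle x.2) :=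
    (continuousOn_dslope_prod (isOpen_annulus R) hf).comp_continuous
      (f := fun x : annulus R × ℝ => ((x.1 : ℂ), expCircle x.2))
      ((continuous_subtype_val.comp continuous_fst).prodMk
        (continuous_expCircle.comp continuous_snd)) (fun x => ⟨x.1.2, expCircle_mem_annulus hR _⟩)
  let H : annulus R → ℝ → ℂ := fun w t => dslope f w (expCircle t)
  have hp : ∀ w t, H w (t + 2 * Real.pi) = H w t := fun w t => by simp only [H, expCircle_add]
  have hne : ∀ w t, H w t ≠ 0 := fun w t =>
    dslope_ne_zero hinj hd w.2 (expCircle_mem_annulus hR t)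
  have hν' : HasWinding (H ⟨w₀, hw₀⟩) ν := hν
  exact HasWinding.of_preconnected (H := H) hc hp hne hν' ⟨w, hw⟩

/-- Hopf's argument: on the torus of pairs of points of the circle the quotient is symmetric, so it
winds `ν` times along each factor, and on the diagonal it equals `f'`. -/
theorem hasWinding_deriv_of_hasWinding_dslope {ν : ℤ}
    (hν : HasWinding (fun t => dslope f (expCircle 0) (expCircle t)) ν) :
    HasWinding (fun t => deriv f (expCircle t)) (2 * ν) := by
  have hmem := expCircle_mem_annulus hR
  let K : ℝ → ℝ → ℂ := fun s t => dslope f (expCircle s) (expCircle t)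
  have hcK : Continuous fun x : ℝ × ℝ => K x.1 x.2 :=
    (continuousOn_dslope_prod (isOpen_annulus R) hf).comp_continuous
      (f := fun x : ℝ × ℝ => (expCircle x.1, expCircle x.2))
      (((continuous_expCircle.comp continuous_fst)).prodMk
        (continuous_expCircle.comp continuous_snd))
      (fun x => ⟨hmem _, hmem _⟩)
  have h0 : ∀ s t, K s t ≠ 0 := fun s t => dslope_ne_zero hinj hd (hmem s) (hmem t)
  have hν' : HasWinding (fun t => K t 0) ν := by
    have e : (fun t => K t 0) = fun t => dslope f (expCircle 0) (expCircle t) :=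
      funext fun t => dslope_comm f _ _
    rw [e]
    exact hν
  have hp : ∀ s t, K (s + 2 * Real.pi) t = K s t := fun s t => by simp only [K, expCircle_add]
  have hp' : ∀ s t, K s (t + 2 * Real.pi) = K s t := fun s t => by simp only [K, expCircle_add]
  have key := HasWinding.diagonal (K := K) hcK hp hp' hν' hν h0
  have e : (fun t => K t t) = fun t => deriv f (expCircle t) := funext fun t => dslope_same f _
  rw [e, ← two_mul] at key
  exact key

/-- For a holomorphic embedding `f` of an annulus, the winding number `ν` of the difference quotient
along the unit circle does not depend on the base point, and `2ν` is the winding number of `f'`. -/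
theorem exists_hasWinding_dslope :
    ∃ ν : ℤ, (∀ w ∈ annulus R, HasWinding (fun t => dslope f w (expCircle t)) ν) ∧
      HasWinding (fun t => deriv f (expCircle t)) (2 * ν) := by
  have hmem := expCircle_mem_annulus hR
  have hc : Continuous fun t : ℝ => dslope f (expCircle 0) (expCircle t) :=
    (continuousOn_dslope_prod (isOpen_annulus R) hf).comp_continuous
      (f := fun t : ℝ => (expCircle 0, expCircle t))
      (continuous_const.prodMk continuous_expCircle) (fun x => ⟨hmem _, hmem _⟩)
  obtain ⟨ν, hν⟩ := HasWinding.exists_of_continuous hc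
    (fun t => dslope_ne_zero hinj hd (hmem 0) (hmem t)) (fun t => by rw [expCircle_add])
  exact ⟨ν, fun w hw => hasWinding_dslope_of_hasWinding hR hf hinj hd (hmem 0) hν hw,
    hasWinding_deriv_of_hasWinding_dslope hR hf hinj hd hν⟩

end dslope

/-! ### The index of a closed curve -/

/-- The winding number about `a` of the image of the unit circle under `f`. -/
def curveIndex (f : ℂ → ℂ) (a : ℂ) : ℤ :=
  open Classical in
  -- Points on the curve itself receive the default value 0.
  if h : ∃ n, HasWinding (fun t => f (expCircle t) - a) n then h.choose else 0

theorem HasWinding.curveIndex_eq {f : ℂ → ℂ} {a : ℂ} {n : ℤ}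
    (h : HasWinding (fun t => f (expCircle t) - a) n) : curveIndex f a = n := by
  have h' : ∃ n, HasWinding (fun t => f (expCircle t) - a) n := ⟨n, h⟩
  rw [curveIndex, dif_pos h']
  exact h'.choose_spec.unique h

section curveIndex

variable {f : ℂ → ℂ} (hf : ContinuousOn f (sphere (0 : ℂ) 1))

include hf

theorem continuous_comp_expCircle : Continuous fun t => f (expCircle t) :=
  hf.comp_continuous continuous_expCircle expCircle_mem_sphere

theorem hasWinding_curveIndex {a : ℂ} (ha : a ∉ f '' sphere (0 : ℂ) 1) :
    HasWinding (fun t => f (expCircle t) - a) (curveIndex f a) := by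
  obtain ⟨n, hn⟩ := HasWinding.exists_of_continuous (g := fun t => f (expCircle t) - a)
    ((continuous_comp_expCircle hf).sub continuous_const)
    (fun t => sub_ne_zero.mpr fun h => ha ⟨_, expCircle_mem_sphere t, h⟩)
    (fun t => by simp only [expCircle_add])
  rwa [hn.curveIndex_eq]

theorem eventually_curveIndex_eq {a : ℂ} (ha : a ∉ f '' sphere (0 : ℂ) 1) :
    ∀ᶠ b in 𝓝 a, curveIndex f b = curveIndex f a := by
  have := (hasWinding_curveIndex hf ha).eventually (X := ℂ)
    (H := fun b t => f (expCircle t) - b)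
    (((continuous_comp_expCircle hf).comp continuous_snd).sub continuous_fst)
    (fun x t => by simp only [expCircle_add])
  filter_upwards [this] with b hb
  exact hb.curveIndex_eq

theorem exists_curveIndex_eq_zero : ∃ M : ℝ, ∀ a, M < ‖a‖ → curveIndex f a = 0 := by
  obtain ⟨M, hM⟩ := (isCompact_sphere (0 : ℂ) 1).exists_bound_of_continuousOn hf
  refine ⟨M, fun a ha => HasWinding.curveIndex_eq ?_⟩
  exact hasWinding_sub_of_norm_lt (continuous_comp_expCircle hf)
    (fun t => by simp only [expCircle_add])
    (fun t => (hM _ (expCircle_mem_sphere t)).trans_lt ha)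

end curveIndex

/-- Factor `f ζ - f w` as the difference quotient times `ζ - w`; the second factor winds once or not
at all according to the side of the circle on which `w` lies. The index thus drops by one across the
curve. -/
theorem curveIndex_apply {f : ℂ → ℂ} {R : ℝ} {ν : ℤ}
    (hν : ∀ w ∈ annulus R, HasWinding (fun t => dslope f w (expCircle t)) ν) {w : ℂ}
    (hw : w ∈ annulus R) :
    (‖w‖ < 1 → curveIndex f (f w) = ν + 1) ∧ (1 < ‖w‖ → curveIndex f (f w) = ν) := by
  have key : ‖w‖ ≠ 1 → ∀ t, dslope f w (expCircle t) * (expCircle t - w) =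
      f (expCircle t) - f w := by
    intro h t
    rw [mul_comm]
    exact sub_smul_dslope f w (expCircle t)
  constructor
  · intro h
    have : HasWinding (fun t => dslope f w (expCircle t) * (expCircle t - w)) (ν + 1) :=
      (hν w hw).mul (hasWinding_exp_sub_of_norm_lt h)
    exact HasWinding.curveIndex_eq (by simpa only [key h.ne] using this)
  · intro h
    have := (hν w hw).mul (hasWinding_sub_of_norm_lt continuous_expCircle expCircle_add (w := w)
      (fun t => by rwa [norm_expCircle]))
    rw [add_zero] at this
    exact HasWinding.curveIndex_eq (by simpa only [key h.ne'] using this)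

/-! ### Decomposed lemniscates and the Riemann–Hurwitz count -/

/-- A decomposition of the lemniscate `|p| = |q|` into finitely many disjoint analytic Jordan curves
such that `p / q` is a power in suitable coordinates near each of them. -/
structure Decomposition (p q : ℂ[X]) where
  ι : Type
  [fintype : Fintype ι]
  f : ι → ℂ → ℂ
  d : ι → ℕ
  R : ℝ
  one_lt : 1 < R
  d_pos : ∀ i, 0 < d i
  differentiableOn : ∀ i, DifferentiableOn ℂ (f i) (annulus R)
  injOn : ∀ i, Set.InjOn (f i) (annulus R)
  eval_eq : ∀ i, ∀ z ∈ annulus R, p.eval (f i z) = z ^ d i * q.eval (f i z)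
  disjoint : Pairwise fun i j => Disjoint (f i '' sphere 0 1) (f j '' sphere 0 1)
  iUnion_eq : ⋃ i, f i '' sphere 0 1 = {z | ‖p.eval z‖ = ‖q.eval z‖}

attribute [instance] Decomposition.fintype

theorem eval_ne_zero_or_of_isCoprime {p q : ℂ[X]} (h : IsCoprime p q) {z : ℂ}
    (hp : p.eval z = 0) (hq : q.eval z = 0) : False := by
  obtain ⟨a, b, hab⟩ := h
  have := congrArg (eval z) hab
  simp [hp, hq] at this

/-- The argument principle for polynomials: split into linear factors and add their winding numbers.
-/
theorem hasWinding_eval {f : ℂ → ℂ} (hf : ContinuousOn f (sphere (0 : ℂ) 1)) {P : ℂ[X]}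
    (hP : P ≠ 0) (h : ∀ z ∈ sphere (0 : ℂ) 1, P.eval (f z) ≠ 0) :
    HasWinding (fun t => P.eval (f (expCircle t))) (P.roots.map (curveIndex f)).sum := by
  have key : ∀ x, P.eval x = P.leadingCoeff * (P.roots.map fun a => x - a).prod := by
    intro x
    conv_lhs => rw [(IsAlgClosed.splits P).eq_prod_roots]
    simp [eval_multiset_prod]
  have h1 := (HasWinding.const (leadingCoeff_ne_zero.mpr hP)).mul
    (HasWinding.multiset_prod P.roots (g := fun a t => f (expCircle t) - a)
      (n := curveIndex f) fun a ha => hasWinding_curveIndex hf ?_)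
  · simpa only [← key, zero_add] using h1
  · rintro ⟨z, hz, rfl⟩
    exact h z hz ((mem_roots hP).mp ha)

namespace Decomposition

variable {p q : ℂ[X]} (D : Decomposition p q) (h : IsCoprime p q) (i : D.ι)

theorem continuousOn : ContinuousOn (D.f i) (sphere 0 1) :=
  (D.differentiableOn i).continuousOn.mono (sphere_subset_annulus D.one_lt)

theorem differentiableAt {z : ℂ} (hz : z ∈ annulus D.R) : DifferentiableAt ℂ (D.f i) z :=
  (D.differentiableOn i).differentiableAt ((isOpen_annulus _).mem_nhds hz)

theorem isCompact_curve : IsCompact (D.f i '' sphere 0 1) :=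
  (isCompact_sphere _ _).image_of_continuousOn (D.continuousOn i)

theorem isClosed_curve : IsClosed (D.f i '' sphere 0 1) := (D.isCompact_curve i).isClosed

theorem curve_subset : D.f i '' sphere 0 1 ⊆ {z | ‖p.eval z‖ = ‖q.eval z‖} := by
  rw [← D.iUnion_eq]
  exact Set.subset_iUnion (fun i => D.f i '' sphere 0 1) i

include h in
theorem eval_denom_ne_zero {z : ℂ} (hz : z ∈ annulus D.R) : q.eval (D.f i z) ≠ 0 := by
  intro hq
  have := D.eval_eq i z hz
  rw [hq, mul_zero] at this
  exact eval_ne_zero_or_of_isCoprime h this hq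

include h in
theorem norm_lt_iff {z : ℂ} (hz : z ∈ annulus D.R) :
    ‖p.eval (D.f i z)‖ < ‖q.eval (D.f i z)‖ ↔ ‖z‖ < 1 := by
  have hq := norm_pos_iff.mpr (D.eval_denom_ne_zero h i hz)
  rw [D.eval_eq i z hz, norm_mul, norm_pow, mul_lt_iff_lt_one_left hq,
    pow_lt_one_iff_of_nonneg (norm_nonneg _) (D.d_pos i).ne']

include h in
theorem norm_gt_iff {z : ℂ} (hz : z ∈ annulus D.R) :
    ‖q.eval (D.f i z)‖ < ‖p.eval (D.f i z)‖ ↔ 1 < ‖z‖ := by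
  have hq := norm_pos_iff.mpr (D.eval_denom_ne_zero h i hz)
  rw [D.eval_eq i z hz, norm_mul, norm_pow, lt_mul_iff_one_lt_left hq,
    one_lt_pow_iff_of_nonneg (norm_nonneg _) (D.d_pos i).ne']

/-- Differentiate `p ∘ f = z ^ d * (q ∘ f)`, multiply by `q ∘ f`, and use the undifferentiated
relation to eliminate the power of `z` from the term with `q'`. -/
theorem wronskian_mul_deriv {z : ℂ} (hz : z ∈ annulus D.R) :
    (wronskian p q).eval (D.f i z) * deriv (D.f i) z =
      -(D.d i) * z ^ (D.d i - 1) * q.eval (D.f i z) ^ 2 := by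
  have hf := (D.differentiableAt i hz).hasDerivAt
  have h1 := (p.hasDerivAt (D.f i z)).comp z hf
  have h2 := (hasDerivAt_pow (D.d i) z).mul ((q.hasDerivAt (D.f i z)).comp z hf)
  have h3 : (eval · p) ∘ D.f i =ᶠ[𝓝 z] fun z => z ^ D.d i * ((eval · q) ∘ D.f i) z := by
    filter_upwards [(isOpen_annulus D.R).mem_nhds hz] with w hw using D.eval_eq i w hw
  have h4 := h1.unique (h2.congr_of_eventuallyEq h3)
  have h5 := D.eval_eq i z hz
  simp only [Function.comp_apply] at h4
  simp only [wronskian, eval_sub, eval_mul]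
  linear_combination (-eval (D.f i z) q) * h4 +
    eval (D.f i z) (derivative q) * deriv (D.f i) z * h5

include h in
theorem wronskian_mul_deriv_ne_zero {z : ℂ} (hz : z ∈ annulus D.R) :
    (wronskian p q).eval (D.f i z) * deriv (D.f i) z ≠ 0 := by
  rw [D.wronskian_mul_deriv i hz]
  have h1 : (D.d i : ℂ) ≠ 0 := Nat.cast_ne_zero.mpr (D.d_pos i).ne'
  exact mul_ne_zero (mul_ne_zero (neg_ne_zero.mpr h1)
    (pow_ne_zero _ (ne_zero_of_mem_annulus D.one_lt hz)))
    (pow_ne_zero _ (D.eval_denom_ne_zero h i hz))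

include h in
theorem deriv_ne_zero : ∀ z ∈ annulus D.R, deriv (D.f i) z ≠ 0 :=
  fun _ hz => right_ne_zero_of_mul (D.wronskian_mul_deriv_ne_zero h i hz)

include h in
theorem map_nhds_eq {z : ℂ} (hz : z ∈ annulus D.R) : map (D.f i) (𝓝 z) = 𝓝 (D.f i z) :=
  (((D.differentiableOn i).analyticAt
    ((isOpen_annulus _).mem_nhds hz)).hasStrictDerivAt).map_nhds_eq (D.deriv_ne_zero h i z hz)

/-- The winding number along the unit circle of the difference quotient of `f i`. -/
def ν : ℤ := (exists_hasWinding_dslope D.one_lt (D.differentiableOn i) (D.injOn i)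
  (D.deriv_ne_zero h i)).choose

theorem hasWinding_dslope : ∀ w ∈ annulus D.R,
    HasWinding (fun t => dslope (D.f i) w (expCircle t)) (D.ν h i) :=
  (exists_hasWinding_dslope D.one_lt (D.differentiableOn i) (D.injOn i)
    (D.deriv_ne_zero h i)).choose_spec.1

theorem hasWinding_deriv : HasWinding (fun t => deriv (D.f i) (expCircle t)) (2 * D.ν h i) :=
  (exists_hasWinding_dslope D.one_lt (D.differentiableOn i) (D.injOn i)
    (D.deriv_ne_zero h i)).choose_spec.2

/-- The winding number of the `i`-th curve about `a`, extended to the curve itself by its value on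
the side where `|q| < |p|`. -/
def index (a : ℂ) : ℤ :=
  open Classical in if a ∈ D.f i '' sphere 0 1 then D.ν h i else curveIndex (D.f i) a

theorem index_of_notMem {a : ℂ} (ha : a ∉ D.f i '' sphere 0 1) :
    D.index h i a = curveIndex (D.f i) a := if_neg ha

theorem eventually_index_eq {a : ℂ} (ha : a ∉ D.f i '' sphere 0 1) :
    ∀ᶠ b in 𝓝 a, D.index h i b = D.index h i a := by
  filter_upwards [eventually_curveIndex_eq (D.continuousOn i) ha,
    (D.isClosed_curve i).isOpen_compl.mem_nhds ha] with b hb hb'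
  rw [index_of_notMem D h i ha, index_of_notMem D h i hb', hb]

open Classical in
theorem index_apply {w : ℂ} (hw : w ∈ annulus D.R) :
    D.index h i (D.f i w) = D.ν h i + if ‖w‖ < 1 then 1 else 0 := by
  have hiff : D.f i w ∈ D.f i '' sphere 0 1 ↔ ‖w‖ = 1 := by
    rw [(D.injOn i).mem_image_iff (sphere_subset_annulus D.one_lt) hw, mem_sphere_zero_iff_norm]
  have hc := curveIndex_apply (D.hasWinding_dslope h i) hw
  rcases lt_trichotomy ‖w‖ 1 with h1 | h1 | h1
  · rw [if_pos h1, index_of_notMem D h i (by rw [hiff]; exact h1.ne), hc.1 h1]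
  · rw [if_neg h1.not_lt, index, if_pos (hiff.mpr h1), add_zero]
  · rw [if_neg h1.not_gt, index_of_notMem D h i (by rw [hiff]; exact h1.ne'), hc.2 h1, add_zero]

open Classical in
/-- The curves of the decomposition together wind once around the points where `|p| < |q|`, and do
not wind around the points where `|q| < |p|`. -/
theorem sum_index (hinf : ∀ᶠ z in Bornology.cobounded ℂ, ‖q.eval z‖ < ‖p.eval z‖) (a : ℂ) :
    ∑ i, D.index h i a = if ‖p.eval a‖ < ‖q.eval a‖ then 1 else 0 := by
  have hcp : Continuous fun z => ‖p.eval z‖ := p.continuous.norm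
  have hcq : Continuous fun z => ‖q.eval z‖ := q.continuous.norm
  -- The difference `G` is locally constant: at a point of the `i`-th curve the other indices do not
  -- change, while the `i`-th index and the indicator jump together. Near infinity both are 0.
  let G : ℂ → ℤ := fun a => ∑ i, D.index h i a - if ‖p.eval a‖ < ‖q.eval a‖ then 1 else 0
  have hG : IsLocallyConstant G := by
    rw [IsLocallyConstant.iff_eventually_eq]
    intro x
    by_cases hx : ‖p.eval x‖ = ‖q.eval x‖
    · have hx' : x ∈ ⋃ i, D.f i '' sphere 0 1 := by rw [D.iUnion_eq]; exact hx
      obtain ⟨i, w, hw, rfl⟩ := Set.mem_iUnion.mp hx'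
      have hwA := sphere_subset_annulus D.one_lt hw
      have h1 : ∀ j ≠ i, ∀ᶠ b in 𝓝 (D.f i w), D.index h j b = D.index h j (D.f i w) :=
        fun j hj => D.eventually_index_eq h j
          (Set.disjoint_left.mp (D.disjoint hj.symm) ⟨w, hw, rfl⟩)
      have h2 : ∀ᶠ b in 𝓝 (D.f i w), ∀ j, j ≠ i → D.index h j b = D.index h j (D.f i w) := by
        rw [eventually_all]
        intro j
        by_cases hj : j = i
        · simp [hj]
        · filter_upwards [h1 j hj] with b hb _ using hb
      have h3 : ∀ᶠ b in 𝓝 (D.f i w), b ∈ D.f i '' annulus D.R := by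
        rw [← D.map_nhds_eq h i hwA]
        exact image_mem_map ((isOpen_annulus _).mem_nhds hwA)
      have h4 : ∀ v ∈ annulus D.R, (D.index h i (D.f i v) -
          if ‖p.eval (D.f i v)‖ < ‖q.eval (D.f i v)‖ then 1 else 0) = D.ν h i := by
        intro v hv
        simp only [D.index_apply h i hv, D.norm_lt_iff h i hv]
        ring
      filter_upwards [h2, h3] with b hb ⟨v, hv, hvb⟩
      subst hvb
      have e1 := h4 v hv
      have e2 := h4 w hwA
      have e3 : ∑ j ∈ Finset.univ.erase i, D.index h j (D.f i v) =
          ∑ j ∈ Finset.univ.erase i, D.index h j (D.f i w) :=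
        Finset.sum_congr rfl fun j hj => hb j (Finset.ne_of_mem_erase hj)
      simp only [G, ← Finset.add_sum_erase _ _ (Finset.mem_univ i), e3]
      linarith
    · have h1 : ∀ᶠ b in 𝓝 x, ∀ j, D.index h j b = D.index h j x := by
        rw [eventually_all]
        refine fun j => D.eventually_index_eq h j fun hj => hx (D.curve_subset j hj)
      have h2 : ∀ᶠ b in 𝓝 x, (‖p.eval b‖ < ‖q.eval b‖ ↔ ‖p.eval x‖ < ‖q.eval x‖) := by
        rcases lt_or_gt_of_ne hx with hlt | hlt
        · filter_upwards [(isOpen_lt hcp hcq).mem_nhds hlt] with b hb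
          exact iff_of_true hb hlt
        · filter_upwards [(isOpen_lt hcq hcp).mem_nhds hlt] with b hb
          exact iff_of_false (not_lt.mpr (le_of_lt hb)) hlt.not_gt
      filter_upwards [h1, h2] with b hb hb'
      simp only [G, hb, hb']
  have hzero : ∃ z, G z = 0 := by
    choose M hM using fun i => exists_curveIndex_eq_zero (D.continuousOn i)
    have hall : ∀ᶠ z in Bornology.cobounded ℂ, ∀ i, M i < ‖z‖ := by
      rw [eventually_all]
      exact fun i => tendsto_norm_cobounded_atTop.eventually_gt_atTop (M i)
    obtain ⟨z, hz1, hz2⟩ := (hinf.and hall).exists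
    refine ⟨z, ?_⟩
    simp only [G, if_neg hz1.not_gt, sub_zero]
    refine Finset.sum_eq_zero fun i _ => ?_
    rw [D.index_of_notMem h i fun hi => hz1.ne' (D.curve_subset i hi), hM i z (hz2 i)]
  obtain ⟨z, hz⟩ := hzero
  have := hG.apply_eq_of_isPreconnected isPreconnected_univ (Set.mem_univ a) (Set.mem_univ z)
  rw [hz] at this
  exact sub_eq_zero.mp this

theorem hasWinding_eval {P : ℂ[X]} (hP : P ≠ 0)
    (h0 : ∀ z ∈ sphere (0 : ℂ) 1, P.eval (D.f i z) ≠ 0) :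
    HasWinding (fun t => P.eval (D.f i (expCircle t))) (P.roots.map (D.index h i)).sum := by
  have h1 := RationalLemniscate.hasWinding_eval (D.continuousOn i) hP h0
  rw [Multiset.map_congr rfl fun a ha => ?_]
  · exact h1
  refine D.index_of_notMem h i ?_
  rintro ⟨z, hz, rfl⟩
  exact h0 z hz ((mem_roots hP).mp ha)

/-- Compare the winding numbers of the two sides of `p ∘ f = z ^ d * (q ∘ f)`. -/
theorem sum_roots_num (hp : p ≠ 0) (hq : q ≠ 0) :
    (p.roots.map (D.index h i)).sum = D.d i + (q.roots.map (D.index h i)).sum := by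
  have hA := sphere_subset_annulus D.one_lt
  have h1 := D.hasWinding_eval h i hq fun z hz => D.eval_denom_ne_zero h i (hA hz)
  have h2 := D.hasWinding_eval h i hp fun z hz => by
    rw [D.eval_eq i z (hA hz)]
    exact mul_ne_zero (pow_ne_zero _ (ne_zero_of_mem_annulus D.one_lt (hA hz)))
      (D.eval_denom_ne_zero h i (hA hz))
  have h3 : HasWinding (fun t => expCircle t ^ D.d i * q.eval (D.f i (expCircle t)))
      (D.d i * 1 + (q.roots.map (D.index h i)).sum) := (HasWinding.exp_mul_I.pow _).mul h1
  simp only [← D.eval_eq i _ (expCircle_mem_annulus D.one_lt _), mul_one] at h3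
  exact h2.unique h3

/-- Compare the winding numbers of the two sides of `wronskian_mul_deriv`; the factor `f'`
contributes `2ν`. -/
theorem sum_roots_wronskian (hW : wronskian p q ≠ 0) (hq : q ≠ 0) :
    ((wronskian p q).roots.map (D.index h i)).sum + 2 * D.ν h i =
      (D.d i - 1) + 2 * (q.roots.map (D.index h i)).sum := by
  have hA := sphere_subset_annulus D.one_lt
  have h1 := D.hasWinding_eval h i hq fun z hz => D.eval_denom_ne_zero h i (hA hz)
  have h2 := D.hasWinding_eval h i hW fun z hz =>
    left_ne_zero_of_mul (D.wronskian_mul_deriv_ne_zero h i (hA hz))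
  have h3 := h2.mul (D.hasWinding_deriv h i)
  have hd : (-(D.d i : ℂ)) ≠ 0 := neg_ne_zero.mpr (Nat.cast_ne_zero.mpr (D.d_pos i).ne')
  have h4 : HasWinding (fun t => -(D.d i : ℂ) * expCircle t ^ (D.d i - 1) *
      q.eval (D.f i (expCircle t)) ^ 2)
      (0 + (D.d i - 1 : ℕ) * 1 + (2 : ℕ) * (q.roots.map (D.index h i)).sum) :=
    ((HasWinding.const hd).mul (HasWinding.exp_mul_I.pow _)).mul (h1.pow 2)
  simp only [← D.wronskian_mul_deriv i (expCircle_mem_annulus D.one_lt _)] at h4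
  have := h3.unique h4
  have hpos := D.d_pos i
  push_cast [Nat.cast_sub (show 1 ≤ D.d i from hpos)] at this
  linarith

open Classical in
/-- Riemann–Hurwitz formula for the region `|p| < |q|`. -/
theorem card_roots_wronskian (hinf : ∀ᶠ z in Bornology.cobounded ℂ, ‖q.eval z‖ < ‖p.eval z‖)
    (hW : wronskian p q ≠ 0) (hp : p ≠ 0) (hq : q ≠ 0) :
    (((wronskian p q).roots.filter fun a => ‖p.eval a‖ < ‖q.eval a‖).card : ℤ) =
      p.natDegree - Fintype.card D.ι - 2 * ∑ i, D.ν h i := by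
  -- Summed over the curves, a root is counted once if it lies in `|p| < |q|` and not at all
  -- otherwise.
  have swap : ∀ s : Multiset ℂ, ∑ i, (s.map (D.index h i)).sum =
      ((s.filter fun a => ‖p.eval a‖ < ‖q.eval a‖).card : ℤ) := by
    intro s
    induction s using Multiset.induction_on with
    | empty => simp
    | cons a s ih =>
      simp only [Multiset.map_cons, Multiset.sum_cons, Finset.sum_add_distrib, ih,
        D.sum_index h hinf, Multiset.filter_cons, Multiset.card_add]
      split_ifs <;> simp
  have e1 := Finset.sum_congr rfl fun i (_ : i ∈ Finset.univ) => D.sum_roots_num h i hp hq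
  have e2 := Finset.sum_congr rfl fun i (_ : i ∈ Finset.univ) => D.sum_roots_wronskian h i hW hq
  simp only [Finset.sum_add_distrib, Finset.sum_sub_distrib, ← Finset.mul_sum, swap] at e1 e2
  -- All zeros of `p` and no zeros of `q` lie in the region, so the first relation gives `∑ d i =
  -- p.natDegree`.
  have hpr : (p.roots.filter fun a => ‖p.eval a‖ < ‖q.eval a‖) = p.roots := by
    rw [Multiset.filter_eq_self]
    intro a ha
    have ha' : p.eval a = 0 := (mem_roots hp).mp ha
    rw [ha', norm_zero]
    exact norm_pos_iff.mpr fun hqa => eval_ne_zero_or_of_isCoprime h ha' hqa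
  have hqr : (q.roots.filter fun a => ‖p.eval a‖ < ‖q.eval a‖) = 0 := by
    rw [Multiset.filter_eq_nil]
    intro a ha
    have ha' : q.eval a = 0 := (mem_roots hq).mp ha
    rw [ha', norm_zero]
    exact not_lt.mpr (norm_nonneg _)
  rw [hpr, hqr] at e1
  rw [hqr] at e2
  rw [← IsAlgClosed.card_roots_eq_natDegree]
  simp at e1 e2 ⊢
  linarith

end Decomposition

/-! ### Lifting the exponential through `p / q` -/

/-- The strip `|Re s| < log ρ`, which `exp` maps onto the annulus `ρ⁻¹ < |z| < ρ`. -/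
def strip (ρ : ℝ) : Set ℂ := {s | -Real.log ρ < s.re ∧ s.re < Real.log ρ}

theorem isOpen_strip (ρ : ℝ) : IsOpen (strip ρ) :=
  (isOpen_lt continuous_const Complex.continuous_re).inter
    (isOpen_lt Complex.continuous_re continuous_const)

theorem convex_strip (ρ : ℝ) : Convex ℝ (strip ρ) :=
  (convex_halfSpace_re_gt _).inter (convex_halfSpace_re_lt _)

theorem exp_mem_annulus_iff {ρ : ℝ} (hρ : 1 < ρ) {s : ℂ} :
    Complex.exp s ∈ annulus ρ ↔ s ∈ strip ρ := by
  have h0 : 0 < ρ := by linarith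
  simp only [annulus, strip, Set.mem_ofPred_eq, Complex.norm_exp]
  rw [← Real.lt_log_iff_exp_lt h0, ← Real.log_lt_iff_lt_exp (inv_pos.mpr h0), Real.log_inv]

theorem zero_mem_strip {ρ : ℝ} (hρ : 1 < ρ) : (0 : ℂ) ∈ strip ρ := by
  have := Real.log_pos hρ
  simp [strip, this]

/-- The inclusion of a set is a local homeomorphism at its interior points. -/
theorem isLocalHomeomorphOn_subtypeVal {X : Type*} [TopologicalSpace X] (K : Set X) :
    IsLocalHomeomorphOn (Subtype.val : K → X) (Subtype.val ⁻¹' interior K) := by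
  classical
  intro x hx
  refine ⟨{ toFun := Subtype.val
            invFun := fun z => if h : z ∈ K then ⟨z, h⟩ else x
            source := Subtype.val ⁻¹' interior K
            target := interior K
            map_source' := fun _ h => h
            map_target' := fun z h => by simpa [interior_subset h] using h
            left_inv' := fun z _ => by simp
            right_inv' := fun z h => by simp [interior_subset h]
            open_source := isOpen_interior.preimage continuous_subtype_val
            open_target := isOpen_interior
            continuousOn_toFun := continuous_subtype_val.continuousOn
            continuousOn_invFun := ?_ }, hx, rfl⟩
  rw [Topology.IsInducing.subtypeVal.continuousOn_iff]
  refine continuousOn_id.congr fun z hz => ?_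
  simp [interior_subset hz]

/-- A continuous function `Φ` on a strip with `(p / q) ∘ Φ = exp`. -/
def IsLift (p q : ℂ[X]) (ρ : ℝ) (Φ : ℂ → ℂ) : Prop :=
  ContinuousOn Φ (strip ρ) ∧ ∀ s ∈ strip ρ, p.eval (Φ s) = Complex.exp s * q.eval (Φ s)

section

variable {p q : ℂ[X]} (h : IsCoprime p q)

theorem hasStrictDerivAt_div {z : ℂ} (hz : q.eval z ≠ 0) :
    HasStrictDerivAt (fun z => p.eval z / q.eval z)
      (-(wronskian p q).eval z / q.eval z ^ 2) z := by
  have e : -(wronskian p q).eval z = (derivative p).eval z * q.eval z -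
      p.eval z * (derivative q).eval z := by
    simp only [wronskian, eval_sub, eval_mul]
    ring
  rw [e]
  exact (p.hasStrictDerivAt z).fun_div (q.hasStrictDerivAt z) hz

variable {ρ : ℝ} (hρ : 1 < ρ)
  (hinf : ∀ᶠ z in Bornology.cobounded ℂ, ρ * ‖q.eval z‖ < ‖p.eval z‖)
  (hW : ∀ z, ‖p.eval z‖ ≤ ρ * ‖q.eval z‖ → ‖q.eval z‖ ≤ ρ * ‖p.eval z‖ →
    (wronskian p q).eval z ≠ 0)

include h in
theorem eval_denom_ne_zero_of_norm_le {z : ℂ} (hz : ‖p.eval z‖ ≤ ρ * ‖q.eval z‖) :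
    q.eval z ≠ 0 := by
  intro hq
  rw [hq, norm_zero, mul_zero, norm_le_zero_iff] at hz
  exact eval_ne_zero_or_of_isCoprime h hz hq

include hinf in
theorem isCompact_norm_le : IsCompact {z | ‖p.eval z‖ ≤ ρ * ‖q.eval z‖} := by
  refine Metric.isCompact_of_isClosed_isBounded
    (isClosed_le p.continuous.norm (continuous_const.mul q.continuous.norm)) ?_
  rw [← Bornology.isCobounded_compl_iff]
  filter_upwards [hinf] with z hz
  exact not_le.mpr hz

include h hρ hinf hW

/-- A local homeomorphism on a compact space is a covering over its image region. Restricting to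
`|p| ≤ ρ |q|` provides compactness and removes the poles; the preimage of the open annulus lies in
the interior of this set, away from critical points. -/
theorem isCoveringMapOn_div :
    IsCoveringMapOn (fun z : {z | ‖p.eval z‖ ≤ ρ * ‖q.eval z‖} => p.eval z.1 / q.eval z.1)
      (annulus ρ) := by
  set K := {z | ‖p.eval z‖ ≤ ρ * ‖q.eval z‖} with hK
  have hq : ∀ z ∈ K, q.eval z ≠ 0 := fun z hz => eval_denom_ne_zero_of_norm_le h hz
  have : CompactSpace K := isCompact_iff_compactSpace.mp (isCompact_norm_le hinf)
  have hcont : Continuous fun z : K => p.eval z.1 / q.eval z.1 :=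
    (p.continuous.comp continuous_subtype_val).div (q.continuous.comp continuous_subtype_val)
      fun z => hq z z.2
  refine IsCoveringMapOn.of_isLocalHomeomorphOn hcont ?_
  have hloc : IsLocalHomeomorphOn (fun z : ℂ => p.eval z / q.eval z)
      {z | q.eval z ≠ 0 ∧ (wronskian p q).eval z ≠ 0} := by
    rintro z ⟨hz1, hz2⟩
    have hd : -(wronskian p q).eval z / q.eval z ^ 2 ≠ 0 :=
      div_ne_zero (neg_ne_zero.mpr hz2) (pow_ne_zero _ hz1)
    exact ⟨_, ((hasStrictDerivAt_div hz1).hasStrictFDerivAt_equiv hd)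
      |>.mem_toOpenPartialHomeomorph_source, rfl⟩
  have hdiv : ∀ z : K, p.eval z.1 / q.eval z.1 ∈ annulus ρ →
      ‖p.eval z.1‖ < ρ * ‖q.eval z.1‖ ∧ ‖q.eval z.1‖ < ρ * ‖p.eval z.1‖ := by
    rintro z ⟨h1, h2⟩
    have hqz := norm_pos_iff.mpr (hq z z.2)
    rw [norm_div] at h1 h2
    rw [lt_div_iff₀ hqz, inv_mul_lt_iff₀ (by linarith)] at h1
    exact ⟨(div_lt_iff₀ hqz).mp h2, h1⟩
  have hint : ∀ z : ℂ, ‖p.eval z‖ < ρ * ‖q.eval z‖ → z ∈ interior K := fun z hz =>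
    interior_mono (fun w (hw : ‖p.eval w‖ < ρ * ‖q.eval w‖) => le_of_lt hw)
      ((isOpen_lt p.continuous.norm
        (continuous_const.mul q.continuous.norm)).interior_eq.symm ▸ hz)
  refine hloc.comp ((isLocalHomeomorphOn_subtypeVal K).mono fun z hz => ?_) fun z hz => ?_
  · exact hint z (hdiv z hz).1
  · exact ⟨hq z z.2, hW z (hdiv z hz).1.le (hdiv z hz).2.le⟩

/-- The strip is simply connected and `exp` maps it into the annulus, so the lifting criterion for
coverings applies. -/
theorem existsUnique_lift {s₀ z₀ : ℂ} (hs₀ : s₀ ∈ strip ρ)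
    (h₀ : p.eval z₀ = Complex.exp s₀ * q.eval z₀) :
    ∃! F : C(strip ρ, {z | ‖p.eval z‖ ≤ ρ * ‖q.eval z‖}), (F ⟨s₀, hs₀⟩ : ℂ) = z₀ ∧
      ∀ s, p.eval (F s).1 = Complex.exp s * q.eval (F s).1 := by
  have hz₀ : ‖p.eval z₀‖ ≤ ρ * ‖q.eval z₀‖ := by
    rw [h₀, norm_mul]
    exact mul_le_mul_of_nonneg_right ((exp_mem_annulus_iff hρ).mpr hs₀).2.le (norm_nonneg _)
  have hne : (strip ρ).Nonempty := ⟨s₀, hs₀⟩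
  have := (convex_strip ρ).contractibleSpace hne
  have : SimplyConnectedSpace (strip ρ) := SimplyConnectedSpace.ofContractible _
  have : LocallyPathConnectedSpace (strip ρ) := (isOpen_strip ρ).locallyPathConnectedSpace
  have hq : ∀ z, ‖p.eval z‖ ≤ ρ * ‖q.eval z‖ → q.eval z ≠ 0 :=
    fun z hz => eval_denom_ne_zero_of_norm_le h hz
  obtain ⟨F, ⟨hF1, hF2⟩, hF3⟩ := (isCoveringMapOn_div h hρ hinf hW).existsUnique_continuousMap_lifts
    (A := strip ρ) ⟨fun s => Complex.exp s, by fun_prop⟩ (a₀ := ⟨s₀, hs₀⟩) (e₀ := ⟨z₀, hz₀⟩)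
    (by simp only [ContinuousMap.coe_mk]; rw [h₀, mul_div_cancel_right₀ _ (hq z₀ hz₀)])
    (fun s => (exp_mem_annulus_iff hρ).mpr s.2)
  refine ⟨F, ⟨congrArg Subtype.val hF1, fun s => ?_⟩, fun F' hF' => hF3 F' ⟨Subtype.ext hF'.1, ?_⟩⟩
  · exact (div_eq_iff (hq _ (F s).2)).mp (congrFun hF2 s)
  · funext s
    exact (div_eq_iff (hq _ (F' s).2)).mpr (hF'.2 s)

theorem exists_isLift {s₀ z₀ : ℂ} (hs₀ : s₀ ∈ strip ρ)
    (h₀ : p.eval z₀ = Complex.exp s₀ * q.eval z₀) :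
    ∃ Φ, IsLift p q ρ Φ ∧ Φ s₀ = z₀ := by
  classical
  obtain ⟨F, ⟨hF1, hF2⟩, -⟩ := existsUnique_lift h hρ hinf hW hs₀ h₀
  have hF : ∀ s : strip ρ, (if hs : (s : ℂ) ∈ strip ρ then (F ⟨s, hs⟩ : ℂ) else 0) = F s :=
    fun s => by simp
  refine ⟨fun s => if hs : s ∈ strip ρ then F ⟨s, hs⟩ else 0, ⟨?_, fun s hs => ?_⟩, ?_⟩
  · rw [continuousOn_iff_continuous_domRestrict]
    refine (continuous_subtype_val.comp F.continuous).congr fun s => ?_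
    exact (hF s).symm
  · simpa only [hF ⟨s, hs⟩] using hF2 ⟨s, hs⟩
  · simpa only [hF ⟨s₀, hs₀⟩] using hF1

theorem IsLift.eqOn {Φ Ψ : ℂ → ℂ} (hΦ : IsLift p q ρ Φ) (hΨ : IsLift p q ρ Ψ) {s₀ : ℂ}
    (hs₀ : s₀ ∈ strip ρ) (h₀ : Φ s₀ = Ψ s₀) : Set.EqOn Φ Ψ (strip ρ) := by
  have hK : ∀ Φ : ℂ → ℂ, IsLift p q ρ Φ → ∀ s ∈ strip ρ,
      ‖p.eval (Φ s)‖ ≤ ρ * ‖q.eval (Φ s)‖ := by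
    intro Φ hΦ s hs
    rw [hΦ.2 s hs, norm_mul]
    exact mul_le_mul_of_nonneg_right ((exp_mem_annulus_iff hρ).mpr hs).2.le (norm_nonneg _)
  let G : ∀ Φ : ℂ → ℂ, IsLift p q ρ Φ → C(strip ρ, {z | ‖p.eval z‖ ≤ ρ * ‖q.eval z‖}) :=
    fun Φ hΦ => ⟨fun s => ⟨Φ s, hK Φ hΦ s s.2⟩,
      (continuousOn_iff_continuous_domRestrict.mp hΦ.1).subtype_mk _⟩
  have := (existsUnique_lift h hρ hinf hW hs₀ (hΦ.2 s₀ hs₀)).unique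
    (y₁ := G Φ hΦ) (y₂ := G Ψ hΨ) ⟨rfl, fun s => hΦ.2 s s.2⟩ ⟨h₀.symm, fun s => hΨ.2 s s.2⟩
  intro s hs
  exact congrArg Subtype.val (DFunLike.congr_fun this ⟨s, hs⟩)

-- Near `Φ s₀` the function `log (r / exp s₀) + s₀` has nonzero derivative and undoes `Φ`, so a
-- continuous `Φ` is automatically differentiable.
omit hinf in
theorem IsLift.differentiableAt {Φ : ℂ → ℂ} (hΦ : IsLift p q ρ Φ) {s₀ : ℂ}
    (hs₀ : s₀ ∈ strip ρ) : DifferentiableAt ℂ Φ s₀ := by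
  have hA := fun s (hs : s ∈ strip ρ) => (exp_mem_annulus_iff hρ).mpr hs
  have hle : ∀ s ∈ strip ρ, ‖p.eval (Φ s)‖ ≤ ρ * ‖q.eval (Φ s)‖ := by
    intro s hs
    rw [hΦ.2 s hs, norm_mul]
    exact mul_le_mul_of_nonneg_right (hA s hs).2.le (norm_nonneg _)
  have hge : ‖q.eval (Φ s₀)‖ ≤ ρ * ‖p.eval (Φ s₀)‖ := by
    have h1 := (inv_lt_iff_one_lt_mul₀ (by linarith)).mp (hA s₀ hs₀).1
    rw [hΦ.2 s₀ hs₀, norm_mul, ← mul_assoc]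
    exact le_mul_of_one_le_left (norm_nonneg _) (by linarith)
  have hq : ∀ s ∈ strip ρ, q.eval (Φ s) ≠ 0 :=
    fun s hs => eval_denom_ne_zero_of_norm_le h (hle s hs)
  have hr : ∀ s ∈ strip ρ, p.eval (Φ s) / q.eval (Φ s) = Complex.exp s := fun s hs => by
    rw [hΦ.2 s hs, mul_div_cancel_right₀ _ (hq s hs)]
  have hc : ContinuousAt Φ s₀ := hΦ.1.continuousAt ((isOpen_strip ρ).mem_nhds hs₀)
  have h1 : p.eval (Φ s₀) / q.eval (Φ s₀) / Complex.exp s₀ = 1 := by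
    rw [hr s₀ hs₀, div_self (Complex.exp_ne_zero _)]
  have hd := (((hasStrictDerivAt_div (hq s₀ hs₀)).hasDerivAt.div_const (Complex.exp s₀)).clog
    (by rw [h1]; exact Complex.one_mem_slitPlane)).add_const s₀
  refine (hd.of_local_left_inverse hc ?_ ?_).differentiableAt
  · refine div_ne_zero (div_ne_zero (div_ne_zero (neg_ne_zero.mpr
      (hW _ (hle s₀ hs₀) hge)) (pow_ne_zero _ (hq s₀ hs₀))) (Complex.exp_ne_zero _)) ?_
    rw [h1]
    exact one_ne_zero
  -- Within distance `π` of `s₀` the principal logarithm inverts `exp (s - s₀)`.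
  · have hnear : ∀ᶠ s in 𝓝 s₀, ‖s - s₀‖ < Real.pi := by
      filter_upwards [Metric.ball_mem_nhds s₀ Real.pi_pos] with s hs
      rwa [← dist_eq_norm]
    filter_upwards [(isOpen_strip ρ).mem_nhds hs₀, hnear] with s hs hs'
    rw [hr s hs, ← Complex.exp_sub, Complex.log_exp, sub_add_cancel]
    · linarith [(abs_lt.mp ((Complex.abs_im_le_norm (s - s₀)).trans_lt hs')).1]
    · linarith [(abs_lt.mp ((Complex.abs_im_le_norm (s - s₀)).trans_lt hs')).2]

end

-- Monodromy of the lifts and the curves of the lemniscate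

local notation "τ" => (2 * Real.pi * Complex.I : ℂ)

theorem add_mul_two_pi_I_mem_strip {ρ : ℝ} {s : ℂ} (n : ℝ) :
    s + n * τ ∈ strip ρ ↔ s ∈ strip ρ := by
  have : (s + n * τ).re = s.re := by simp
  simp only [strip, Set.mem_ofPred_eq, this]

/-- The lifts of `exp` through `p / q`, indexed by their values at `0`. -/
structure LiftSystem (p q : ℂ[X]) (ρ : ℝ) where
  Φ : {x // p.eval x = q.eval x} → ℂ → ℂ
  isLift : ∀ x, IsLift p q ρ (Φ x)
  apply_zero : ∀ x, Φ x 0 = x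
  coprime : IsCoprime p q
  one_lt : 1 < ρ
  tendsto : ∀ᶠ z in Bornology.cobounded ℂ, ρ * ‖q.eval z‖ < ‖p.eval z‖
  wronskian_ne : ∀ z, ‖p.eval z‖ ≤ ρ * ‖q.eval z‖ → ‖q.eval z‖ ≤ ρ * ‖p.eval z‖ →
    (wronskian p q).eval z ≠ 0

namespace LiftSystem

variable {p q : ℂ[X]} {ρ : ℝ} (A : LiftSystem p q ρ)

include A in
theorem finite : Finite {x // p.eval x = q.eval x} := by
  have hne : p - q ≠ 0 := by
    intro h0
    have hW : wronskian p q = 0 := by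
      rw [sub_eq_zero.mp h0, wronskian_self_eq_zero]
    obtain ⟨hp, -⟩ := A.coprime.wronskian_eq_zero_iff.mp hW
    have hpc := eq_C_of_derivative_eq_zero hp
    obtain ⟨z, hz⟩ := A.tendsto.exists
    have := A.one_lt
    rw [← sub_eq_zero.mp h0] at hz
    nlinarith [norm_nonneg (p.eval z)]
  refine (finite_setOfPred_isRoot hne).subset fun x hx => ?_
  have hx' : p.eval x = q.eval x := hx
  simp [hx']

theorem eval_denom_ne_zero (x) {s : ℂ} (hs : s ∈ strip ρ) : q.eval (A.Φ x s) ≠ 0 := by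
  intro hq
  have := (A.isLift x).2 s hs
  rw [hq, mul_zero] at this
  exact eval_ne_zero_or_of_isCoprime A.coprime this hq

theorem eq_of_apply_eq {Ψ : ℂ → ℂ} (hΨ : IsLift p q ρ Ψ) {x} {s : ℂ} (hs : s ∈ strip ρ)
    (h : Ψ s = A.Φ x s) : Set.EqOn Ψ (A.Φ x) (strip ρ) :=
  IsLift.eqOn A.coprime A.one_lt A.tendsto A.wronskian_ne hΨ (A.isLift x) hs h

theorem injective {x y} {s : ℂ} (hs : s ∈ strip ρ) (h : A.Φ x s = A.Φ y s) : x = y := by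
  have := A.eq_of_apply_eq (A.isLift x) hs h (zero_mem_strip A.one_lt)
  rw [A.apply_zero, A.apply_zero] at this
  exact Subtype.ext this

include A in
theorem tau_mem_strip : τ ∈ strip ρ := by
  simpa using (add_mul_two_pi_I_mem_strip (s := 0) 1).mpr (zero_mem_strip A.one_lt)

/-- The monodromy along the unit circle. -/
def T (x : {x // p.eval x = q.eval x}) : {x // p.eval x = q.eval x} :=
  ⟨A.Φ x τ, by simpa using (A.isLift x).2 τ A.tau_mem_strip⟩

theorem T_injective : Function.Injective A.T := fun _ _ h =>
  A.injective A.tau_mem_strip (congrArg Subtype.val h)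

/-- Translating a lift by the period `τ` of `exp` gives another lift, identified by its value at 0,
which is the monodromy image. -/
theorem apply_add (x) (m : ℕ) {s : ℂ} (hs : s ∈ strip ρ) :
    A.Φ x (s + m * τ) = A.Φ (A.T^[m] x) s := by
  have hstep : ∀ x, ∀ s ∈ strip ρ, A.Φ x (s + τ) = A.Φ (A.T x) s := by
    intro x s hs
    have hmem : ∀ s ∈ strip ρ, s + τ ∈ strip ρ := fun s hs => by
      simpa using (add_mul_two_pi_I_mem_strip 1).mpr hs
    have hl : IsLift p q ρ fun s => A.Φ x (s + τ) := by
      refine ⟨(A.isLift x).1.comp (by fun_prop) hmem, fun s hs => ?_⟩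
      rw [(A.isLift x).2 _ (hmem s hs), Complex.exp_add, Complex.exp_two_pi_mul_I, mul_one]
    exact A.eq_of_apply_eq hl (zero_mem_strip A.one_lt) (by simp [A.apply_zero, T]) hs
  induction m generalizing x with
  | zero => simp
  | succ m ih =>
    have hs' : s + m * τ ∈ strip ρ := by
      simpa using (add_mul_two_pi_I_mem_strip (m : ℝ)).mpr hs
    rw [Function.iterate_succ_apply, ← ih, ← hstep x _ hs']
    congr 1
    push_cast
    ring

/-- Equal values have equal images under `p / q`, so `s` and `s'` differ by an integer multiple of
`τ`. Two cases appear because `T` is only iterated forwards. -/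
theorem eq_or_eq_of_apply_eq {x y} {s s' : ℂ} (hs : s ∈ strip ρ) (hs' : s' ∈ strip ρ)
    (h : A.Φ x s = A.Φ y s') :
    ∃ m : ℕ, (A.T^[m] x = y ∧ s = s' + m * τ) ∨ (A.T^[m] y = x ∧ s' = s + m * τ) := by
  have h1 := (A.isLift x).2 s hs
  have h2 := (A.isLift y).2 s' hs'
  rw [← h, h1] at h2
  obtain ⟨n, hn⟩ := Complex.exp_eq_exp_iff_exists_int.mp
    (mul_right_cancel₀ (A.eval_denom_ne_zero x hs) h2)
  obtain ⟨m, rfl | rfl⟩ := n.eq_nat_or_neg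
  · refine ⟨m, Or.inl ⟨A.injective hs' ?_, by simpa using hn⟩⟩
    rw [← A.apply_add x m hs', ← h, hn]
    simp
  · have hn' : s' = s + m * τ := by
      rw [hn]
      push_cast
      ring
    refine ⟨m, Or.inr ⟨A.injective hs ?_, hn'⟩⟩
    rw [← A.apply_add y m hs, h, hn']

/-- The period of a point of the fiber under the monodromy. -/
def d (x : {x // p.eval x = q.eval x}) : ℕ := Function.minimalPeriod A.T x

theorem mem_periodicPts (x) : x ∈ Function.periodicPts A.T := by
  have := A.finite
  exact A.T_injective.mem_periodicPts x

theorem d_pos (x) : 0 < A.d x :=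
  Function.minimalPeriod_pos_of_mem_periodicPts (A.mem_periodicPts x)

theorem iterate_mul_d (x) (m : ℕ) : A.T^[m * A.d x] x = x :=
  (Function.isPeriodicPt_minimalPeriod A.T x).const_mul m

theorem apply_add_mul_d (x) (n : ℤ) {s : ℂ} (hs : s ∈ strip ρ) :
    A.Φ x (s + n * A.d x * τ) = A.Φ x s := by
  have key : ∀ m : ℕ, ∀ s ∈ strip ρ, A.Φ x (s + m * A.d x * τ) = A.Φ x s := by
    intro m s hs
    have := A.apply_add x (m * A.d x) hs
    rw [iterate_mul_d] at this
    rw [← this]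
    push_cast
    rfl
  obtain ⟨m, rfl | rfl⟩ := n.eq_nat_or_neg
  · simpa using key m s hs
  · rw [← key m _ (by simpa using (add_mul_two_pi_I_mem_strip (-(m : ℝ) * A.d x)).mpr hs)]
    congr 1
    push_cast
    ring

/-- The coordinate in which `p / q` becomes the power `A.d x`. -/
def f (x : {x // p.eval x = q.eval x}) (z : ℂ) : ℂ := A.Φ x (A.d x * Complex.log z)

/-- Any logarithm of the point may replace the principal one, because the lift has period `A.d x *
τ`. -/
theorem f_exp (x) {s : ℂ} (hs : A.d x * s ∈ strip ρ) : A.f x (Complex.exp s) = A.Φ x (A.d x * s) := by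
  obtain ⟨n, hn⟩ := Complex.exp_eq_exp_iff_exists_int.mp (Complex.exp_log (Complex.exp_ne_zero s))
  rw [f, hn, ← A.apply_add_mul_d x n hs]
  congr 1
  ring

theorem mul_log_mem_strip {R : ℝ} (hR : 1 < R) {x} (hRx : R ^ A.d x ≤ ρ) {z : ℂ}
    (hz : z ∈ annulus R) : A.d x * Complex.log z ∈ strip ρ := by
  have hd : (0 : ℝ) < A.d x := Nat.cast_pos.mpr (A.d_pos x)
  have h0 : 0 < ‖z‖ := norm_pos_iff.mpr (ne_zero_of_mem_annulus hR hz)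
  have h1 : Real.log ‖z‖ < Real.log R := Real.log_lt_log h0 hz.2
  have h2 : -Real.log R < Real.log ‖z‖ := by
    rw [← Real.log_inv]
    exact Real.log_lt_log (inv_pos.mpr (by linarith)) hz.1
  have h3 : A.d x * Real.log R ≤ Real.log ρ := by
    rw [← Real.log_pow]
    exact Real.log_le_log (pow_pos (by linarith) _) hRx
  have e : (A.d x * Complex.log z).re = A.d x * Real.log ‖z‖ := by
    simp [Complex.log_re]
  simp only [strip, Set.mem_ofPred_eq, e]
  constructor <;> nlinarith

section

variable {R : ℝ} (hR : 1 < R) {x : {x // p.eval x = q.eval x}} (hRx : R ^ A.d x ≤ ρ)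

include hR hRx

theorem eval_f {z : ℂ} (hz : z ∈ annulus R) :
    p.eval (A.f x z) = z ^ A.d x * q.eval (A.f x z) := by
  rw [f, (A.isLift x).2 _ (A.mul_log_mem_strip hR hRx hz), Complex.exp_nat_mul,
    Complex.exp_log (ne_zero_of_mem_annulus hR hz)]

/-- Near `z₀` the branch `log (z / z₀) + log z₀` is holomorphic even if `z₀` is on the cut of the
principal logarithm, and `f` does not depend on the branch. -/
theorem differentiableOn_f : DifferentiableOn ℂ (A.f x) (annulus R) := by
  intro z₀ hz₀
  apply DifferentiableAt.differentiableWithinAt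
  have h0 := ne_zero_of_mem_annulus hR hz₀
  have hs₀ := A.mul_log_mem_strip hR hRx hz₀
  let g : ℂ → ℂ := fun z => A.d x * (Complex.log (z / z₀) + Complex.log z₀)
  have hg₀ : g z₀ = A.d x * Complex.log z₀ := by simp [g, h0]
  have hg : DifferentiableAt ℂ g z₀ := by
    refine (((differentiableAt_id.div_const z₀).clog ?_).add_const _).const_mul _
    simp [h0, Complex.one_mem_slitPlane]
  have hΦ : DifferentiableAt ℂ (A.Φ x ∘ g) z₀ := by
    refine DifferentiableAt.comp z₀ ?_ hg
    rw [hg₀]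
    exact (A.isLift x).differentiableAt A.coprime A.one_lt A.wronskian_ne hs₀
  refine hΦ.congr_of_eventuallyEq ?_
  have h1 : ∀ᶠ z in 𝓝 z₀, g z ∈ strip ρ :=
    hg.continuousAt.eventually_mem ((isOpen_strip ρ).mem_nhds (hg₀ ▸ hs₀))
  filter_upwards [h1, isOpen_ne.mem_nhds h0] with z hz hz0
  rw [Function.comp_apply, ← A.f_exp x hz, Complex.exp_add, Complex.exp_log (div_ne_zero hz0 h0),
    Complex.exp_log h0, div_mul_cancel₀ _ h0]

/-- Two parameters with the same image differ by `m * τ` with `T^[m]` fixing `x`; the minimal period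
divides `m`, so the logarithms differ by a multiple of `τ`. -/
theorem injOn_f : Set.InjOn (A.f x) (annulus R) := by
  have key : ∀ z ∈ annulus R, ∀ w ∈ annulus R, ∀ m : ℕ, A.T^[m] x = x →
      A.d x * Complex.log z = A.d x * Complex.log w + m * τ → z = w := by
    intro z hz w hw m hm h
    obtain ⟨c, rfl⟩ : A.d x ∣ m := Function.IsPeriodicPt.minimalPeriod_dvd hm
    have hd : (A.d x : ℂ) ≠ 0 := Nat.cast_ne_zero.mpr (A.d_pos x).ne'
    have h' : Complex.log z = Complex.log w + (c : ℤ) * τ := by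
      apply mul_left_cancel₀ hd
      rw [h]
      push_cast
      ring
    rw [← Complex.exp_log (ne_zero_of_mem_annulus hR hz),
      ← Complex.exp_log (ne_zero_of_mem_annulus hR hw), h', Complex.exp_add,
      Complex.exp_int_mul_two_pi_mul_I, mul_one]
  intro z hz w hw hzw
  obtain ⟨m, ⟨h1, h2⟩ | ⟨h1, h2⟩⟩ := A.eq_or_eq_of_apply_eq (A.mul_log_mem_strip hR hRx hz)
    (A.mul_log_mem_strip hR hRx hw) hzw
  · exact key z hz w hw m h1 h2
  · exact (key w hw z hz m h1 h2).symm

end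

theorem equivalence : Equivalence fun x y => ∃ m : ℕ, A.T^[m] x = y where
  refl x := ⟨0, rfl⟩
  symm := by
    rintro x _ ⟨m, rfl⟩
    -- Since `m * A.d x` turns return to `x`, the remaining `m * A.d x - m` turns undo the first
    -- `m`.
    have hm : m ≤ m * A.d x := Nat.le_mul_of_pos_right m (A.d_pos x)
    refine ⟨m * A.d x - m, ?_⟩
    rw [← Function.iterate_add_apply, Nat.sub_add_cancel hm, A.iterate_mul_d]
  trans := by
    rintro x _ _ ⟨m, rfl⟩ ⟨n, rfl⟩
    exact ⟨n + m, Function.iterate_add_apply _ _ _ _⟩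

/-- The orbits of the monodromy. -/
def setoid : Setoid {x // p.eval x = q.eval x} := ⟨_, A.equivalence⟩

-- Each monodromy orbit yields one curve, traversed once after as many turns as the orbit has
-- elements.
include A in
theorem nonempty_decomposition : Nonempty (Decomposition p q) := by
  have hfin := A.finite
  let _ := A.setoid
  have _ := Fintype.ofFinite (Quotient A.setoid)
  -- The fiber is finite, so one radius close to 1 serves all the powers.
  obtain ⟨R, hR, hRx⟩ : ∃ R : ℝ, 1 < R ∧ ∀ x, R ^ A.d x ≤ ρ := by
    have h1 : ∀ᶠ R : ℝ in 𝓝[>] 1, ∀ x, R ^ A.d x ≤ ρ := by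
      rw [eventually_all]
      intro x
      have hc : Tendsto (fun R : ℝ => R ^ A.d x) (𝓝[>] 1) (𝓝 (1 ^ A.d x)) :=
        ((continuous_pow (A.d x)).tendsto 1).mono_left nhdsWithin_le_nhds
      rw [one_pow] at hc
      exact (hc.eventually_lt_const A.one_lt).mono fun _ => le_of_lt
    obtain ⟨R, h2, h3⟩ := (h1.and self_mem_nhdsWithin).exists
    exact ⟨R, h3, h2⟩
  have hsph : ∀ z ∈ sphere (0 : ℂ) 1, z ∈ annulus R := sphere_subset_annulus hR
  refine ⟨⟨Quotient A.setoid, fun i => A.f i.out, fun i => A.d i.out, R, hR, fun i => A.d_pos _,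
    fun i => A.differentiableOn_f hR (hRx _), fun i => A.injOn_f hR (hRx _),
    fun i z hz => A.eval_f hR (hRx _) hz, fun i j hij => ?_, ?_⟩⟩
  · refine Set.disjoint_left.mpr ?_
    rintro _ ⟨z, hz, rfl⟩ ⟨w, hw, hzw⟩
    apply hij
    rw [← Quotient.out_eq i, ← Quotient.out_eq j]
    apply Quotient.sound
    obtain ⟨m, ⟨h1, -⟩ | ⟨h1, -⟩⟩ := A.eq_or_eq_of_apply_eq
      (A.mul_log_mem_strip hR (hRx _) (hsph w hw)) (A.mul_log_mem_strip hR (hRx _) (hsph z hz)) hzw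
    · exact A.equivalence.symm ⟨m, h1⟩
    · exact ⟨m, h1⟩
  · ext z
    rw [Set.mem_iUnion]
    constructor
    · rintro ⟨i, w, hw, rfl⟩
      simp only [Set.mem_ofPred_eq]
      rw [A.eval_f hR (hRx _) (hsph w hw), norm_mul, norm_pow, mem_sphere_zero_iff_norm.mp hw,
        one_pow, one_mul]
    · intro hz
      have hqz : q.eval z ≠ 0 := by
        intro h0
        have hz' : ‖p.eval z‖ = ‖q.eval z‖ := hz
        rw [h0, norm_zero, norm_eq_zero] at hz'
        exact eval_ne_zero_or_of_isCoprime A.coprime hz' h0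
      have hw1 : ‖p.eval z / q.eval z‖ = 1 := by
        rw [norm_div, div_eq_one_iff_eq (norm_ne_zero_iff.mpr hqz)]
        exact hz
      set s := Complex.log (p.eval z / q.eval z) with hsdef
      have hs_re : s.re = 0 := by rw [hsdef, Complex.log_re, hw1, Real.log_one]
      have hexp : Complex.exp s = p.eval z / q.eval z :=
        Complex.exp_log (norm_ne_zero_iff.mp (by rw [hw1]; exact one_ne_zero))
      have hstrip : ∀ s : ℂ, s.re = 0 → s ∈ strip ρ := fun s hs => by
        have := Real.log_pos A.one_lt
        simp [strip, hs, this]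
      -- A lift through `z` is one of the system: its value at 0 lies in the fiber over 1.
      obtain ⟨Ψ, hΨ, hΨz⟩ := exists_isLift A.coprime A.one_lt A.tendsto A.wronskian_ne
        (hstrip s hs_re) (z₀ := z) (by rw [hexp, div_mul_cancel₀ _ hqz])
      let x : {x // p.eval x = q.eval x} := ⟨Ψ 0, by simpa using hΨ.2 0 (zero_mem_strip A.one_lt)⟩
      have hx : A.Φ x s = z := by
        rw [← hΨz]
        exact (A.eq_of_apply_eq hΨ (zero_mem_strip A.one_lt) (A.apply_zero x).symm
          (hstrip s hs_re)).symm
      obtain ⟨m, hm⟩ : ∃ m : ℕ, A.T^[m] (⟦x⟧ : Quotient A.setoid).out = x :=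
        Quotient.exact (Quotient.out_eq (⟦x⟧ : Quotient A.setoid))
      set y := (⟦x⟧ : Quotient A.setoid).out
      have hd : (A.d y : ℂ) ≠ 0 := Nat.cast_ne_zero.mpr (A.d_pos y).ne'
      have hds : A.d y * ((s + m * τ) / A.d y) = s + m * τ := mul_div_cancel₀ _ hd
      have hre : (s + m * τ).re = 0 := by simp [hs_re]
      -- The representative `y` reaches `x` after `m` turns, so `z` is the value of the lift of `y`
      -- at `s + m * τ`; dividing by the period gives the point of the circle.
      refine ⟨⟦x⟧, Complex.exp ((s + m * τ) / A.d y), ?_, ?_⟩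
      · rw [mem_sphere_zero_iff_norm, Complex.norm_exp, Complex.div_natCast_re, hre, zero_div,
          Real.exp_zero]
      · change A.f y _ = z
        rw [A.f_exp y (by rw [hds]; exact hstrip _ hre), hds, A.apply_add y m (hstrip s hs_re),
          hm, hx]

end LiftSystem

/-- If `p / q` has no critical points on the lemniscate `|p| = |q|`, then the lemniscate is a
disjoint union of analytic Jordan curves. -/
theorem exists_decomposition {p q : ℂ[X]} (h : IsCoprime p q)
    (hinf : ∃ ρ > (1 : ℝ), ∀ᶠ z in Bornology.cobounded ℂ, ρ * ‖q.eval z‖ < ‖p.eval z‖)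
    (hW0 : wronskian p q ≠ 0)
    (hW : ∀ z, ‖p.eval z‖ = ‖q.eval z‖ → (wronskian p q).eval z ≠ 0) :
    Nonempty (Decomposition p q) := by
  obtain ⟨ρ₀, hρ₀, hinf⟩ := hinf
  -- There are finitely many critical points and none with `|p| = |q|`, so a sufficiently thin
  -- annulus avoids all critical values.
  have key : ∀ᶠ ρ : ℝ in 𝓝[>] 1, ∀ z ∈ {z | (wronskian p q).IsRoot z},
      ¬ (‖p.eval z‖ ≤ ρ * ‖q.eval z‖ ∧ ‖q.eval z‖ ≤ ρ * ‖p.eval z‖) := by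
    rw [eventually_all_finite (finite_setOfPred_isRoot hW0)]
    intro z hz
    have hne : ‖p.eval z‖ ≠ ‖q.eval z‖ := fun e => hW z e hz
    have hc : ∀ c : ℝ, Tendsto (fun ρ : ℝ => ρ * c) (𝓝[>] 1) (𝓝 c) := fun c => by
      have : Tendsto (fun ρ : ℝ => ρ * c) (𝓝[>] 1) (𝓝 (1 * c)) :=
        ((continuous_mul_const c).tendsto 1).mono_left nhdsWithin_le_nhds
      rwa [one_mul] at this
    rcases lt_or_gt_of_ne hne with hlt | hlt
    · filter_upwards [(hc ‖p.eval z‖).eventually_lt_const hlt] with ρ hρ h2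
      exact h2.2.not_gt hρ
    · filter_upwards [(hc ‖q.eval z‖).eventually_lt_const hlt] with ρ hρ h2
      exact h2.1.not_gt hρ
  have hle : ∀ᶠ ρ : ℝ in 𝓝[>] 1, ρ < ρ₀ :=
    nhdsWithin_le_nhds (eventually_lt_nhds hρ₀)
  obtain ⟨ρ, ⟨h1, h2⟩, h3⟩ := ((key.and hle).and self_mem_nhdsWithin).exists
  have hρ : 1 < ρ := h3
  have hinf' : ∀ᶠ z in Bornology.cobounded ℂ, ρ * ‖q.eval z‖ < ‖p.eval z‖ := by
    filter_upwards [hinf] with z hz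
    exact (mul_le_mul_of_nonneg_right h2.le (norm_nonneg _)).trans_lt hz
  have hW' : ∀ z, ‖p.eval z‖ ≤ ρ * ‖q.eval z‖ → ‖q.eval z‖ ≤ ρ * ‖p.eval z‖ →
      (wronskian p q).eval z ≠ 0 := fun z a b c => h1 z c ⟨a, b⟩
  have hex : ∀ x : {x // p.eval x = q.eval x}, ∃ Φ, IsLift p q ρ Φ ∧ Φ 0 = x := fun x =>
    exists_isLift h hρ hinf' hW' (zero_mem_strip hρ) (by simp [x.2])
  choose Φ hΦ hΦ0 using hex
  exact LiftSystem.nonempty_decomposition ⟨Φ, hΦ, hΦ0, h, hρ, hinf', hW'⟩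

/-! ### Critical multiplicities as zeros of the Wronskian -/

/-- With `g = (X - a) ^ (m + 1) * h`, the factor `(X - a) ^ m` comes out of the Wronskian, and the
cofactor at `a` is `-(m + 1) * h a * s a`. -/
theorem rootMultiplicity_wronskian {g s : ℂ[X]} {a : ℂ} (hg : g.eval a = 0) (hs : s.eval a ≠ 0)
    (hW : wronskian g s ≠ 0) :
    (wronskian g s).rootMultiplicity a = g.rootMultiplicity a - 1 := by
  have hg0 : g ≠ 0 := by
    rintro rfl
    simp at hW
  obtain ⟨h, hgh, hh⟩ := exists_eq_pow_rootMultiplicity_mul_and_not_dvd g hg0 a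
  have hm : 0 < g.rootMultiplicity a := (rootMultiplicity_pos hg0).mpr hg
  obtain ⟨m, hm'⟩ := Nat.exists_eq_add_of_lt hm
  rw [zero_add] at hm'
  rw [hm'] at hgh ⊢
  have hha : h.eval a ≠ 0 := fun e => hh (dvd_iff_isRoot.mpr e)
  have key : wronskian g s = (X - C a) ^ m *
      ((X - C a) * (h * derivative s - derivative h * s) - C ((m : ℂ) + 1) * h * s) := by
    rw [hgh, wronskian]
    simp only [derivative_mul, derivative_pow, derivative_sub, derivative_X, derivative_C]
    simp only [Nat.add_sub_cancel, map_add, map_natCast, map_one, Nat.cast_add, Nat.cast_one]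
    ring
  have hne : eval a ((X - C a) * (h * derivative s - derivative h * s) -
      C ((m : ℂ) + 1) * h * s) ≠ 0 := by
    simp only [eval_sub, eval_mul, eval_X, eval_C, sub_self, zero_mul, zero_sub]
    exact neg_ne_zero.mpr (mul_ne_zero (mul_ne_zero (Nat.cast_add_one_ne_zero m) hha) hs)
  rw [key, rootMultiplicity_mul (key ▸ hW), rootMultiplicity_X_sub_C_pow,
    rootMultiplicity_eq_zero hne]
  rfl

/-- The top coefficient is the product of the leading coefficients times the difference of the
degrees. Multiplying by `X` avoids truncated subtraction in the degree of a derivative. -/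
theorem natDegree_wronskian_add_one {g s : ℂ[X]} (hW : wronskian g s ≠ 0)
    (hne : g.natDegree ≠ s.natDegree) :
    (wronskian g s).natDegree + 1 = g.natDegree + s.natDegree := by
  have hg0 : g ≠ 0 := by
    rintro rfl
    simp at hW
  have hs0 : s ≠ 0 := by
    rintro rfl
    simp at hW
  have hdeg : ∀ u : ℂ[X], (X * derivative u).natDegree ≤ u.natDegree := by
    intro u
    rw [natDegree_le_iff_coeff_eq_zero]
    rintro (_ | n) hn
    · simp
    · rw [coeff_X_mul, coeff_derivative, coeff_eq_zero_of_natDegree_lt hn, zero_mul]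
  have hcoeff : ∀ u : ℂ[X], (X * derivative u).coeff u.natDegree =
      u.natDegree * u.leadingCoeff := by
    intro u
    rw [leadingCoeff]
    rcases h : u.natDegree with _ | n
    · simp
    · rw [coeff_X_mul, coeff_derivative]
      push_cast
      ring
  have key : X * wronskian g s = g * (X * derivative s) - (X * derivative g) * s := by
    rw [wronskian]
    ring
  have h1 : (X * wronskian g s).natDegree = g.natDegree + s.natDegree := by
    apply natDegree_eq_of_le_of_coeff_ne_zero
    · rw [key]
      refine (natDegree_sub_le _ _).trans (max_le ?_ ?_)
      · exact natDegree_mul_le.trans (Nat.add_le_add_left (hdeg s) _)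
      · exact natDegree_mul_le.trans (Nat.add_le_add_right (hdeg g) _)
    · rw [key, coeff_sub, coeff_mul_add_eq_of_natDegree_le le_rfl (hdeg s),
        coeff_mul_add_eq_of_natDegree_le (hdeg g) le_rfl, hcoeff, hcoeff, coeff_natDegree,
        coeff_natDegree]
      have e : g.leadingCoeff * (s.natDegree * s.leadingCoeff) -
          g.natDegree * g.leadingCoeff * s.leadingCoeff =
          ((s.natDegree : ℂ) - g.natDegree) * (g.leadingCoeff * s.leadingCoeff) := by ring
      rw [e]
      exact mul_ne_zero (sub_ne_zero.mpr fun e => hne (Nat.cast_injective e).symm)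
        (mul_ne_zero (leadingCoeff_ne_zero.mpr hg0) (leadingCoeff_ne_zero.mpr hs0))
  rw [← h1, natDegree_X_mul hW]

theorem wronskian_sub_C_mul (p q : ℂ[X]) (w : ℂ) : wronskian (p - C w * q) q = wronskian p q := by
  simp only [wronskian, derivative_sub, derivative_C_mul]
  ring

/-! ### Values of `r` on the sphere and behavior at infinity -/

section membership

variable (r : RatFunc ℂ) (a : ℂ)

theorem toSphere_coe_of_eq_zero (h : r.denom.eval a = 0) : toSphere r a = OnePoint.infty :=
  if_pos h

theorem toSphere_coe_of_ne_zero (h : r.denom.eval a ≠ 0) :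
    toSphere r a = ((r.num.eval a / r.denom.eval a : ℂ) : OnePoint ℂ) := if_neg h

theorem denom_ne_zero_of_norm_le (h : ‖r.num.eval a‖ ≤ ‖r.denom.eval a‖) :
    r.denom.eval a ≠ 0 := by
  intro h0
  rw [h0, norm_zero, norm_le_zero_iff] at h
  exact eval_ne_zero_or_of_isCoprime (RatFunc.isCoprime_num_denom r) h h0

theorem toSphere_coe_eq_infty_iff : toSphere r a = OnePoint.infty ↔ r.denom.eval a = 0 := by
  by_cases h : r.denom.eval a = 0
  · simp [toSphere_coe_of_eq_zero r a h, h]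
  · simp [toSphere_coe_of_ne_zero r a h, h]

theorem toSphere_coe_eq_coe_iff (w : ℂ) : toSphere r a = (w : OnePoint ℂ) ↔
    r.denom.eval a ≠ 0 ∧ r.num.eval a / r.denom.eval a = w := by
  by_cases h : r.denom.eval a = 0
  · simp [toSphere_coe_of_eq_zero r a h, h]
  · simp [toSphere_coe_of_ne_zero r a h, h]

theorem toSphere_coe_eq_zero_iff :
    toSphere r a = ((0 : ℂ) : OnePoint ℂ) ↔ r.num.eval a = 0 := by
  rw [toSphere_coe_eq_coe_iff]
  constructor
  · rintro ⟨h1, h2⟩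
    exact (div_eq_zero_iff.mp h2).resolve_right h1
  · intro h
    exact ⟨fun h0 => eval_ne_zero_or_of_isCoprime (RatFunc.isCoprime_num_denom r) h h0,
      by rw [h, zero_div]⟩

theorem toSphere_coe_mem_image_iff (s : Set ℂ) : toSphere r a ∈ ((↑) : ℂ → OnePoint ℂ) '' s ↔
    r.denom.eval a ≠ 0 ∧ r.num.eval a / r.denom.eval a ∈ s := by
  by_cases h : r.denom.eval a = 0
  · simp [toSphere_coe_of_eq_zero r a h, h]
  · simp [toSphere_coe_of_ne_zero r a h, h]

theorem toSphere_coe_mem_disk_iff :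
    toSphere r a ∈ disk ↔ ‖r.num.eval a‖ < ‖r.denom.eval a‖ := by
  rw [disk, toSphere_coe_mem_image_iff, mem_ball_zero_iff, norm_div]
  constructor
  · rintro ⟨h1, h2⟩
    exact (div_lt_one (norm_pos_iff.mpr h1)).mp h2
  · intro h
    have h1 := denom_ne_zero_of_norm_le r a h.le
    exact ⟨h1, (div_lt_one (norm_pos_iff.mpr h1)).mpr h⟩

theorem toSphere_coe_mem_closedDisk_iff :
    toSphere r a ∈ closedDisk ↔ ‖r.num.eval a‖ ≤ ‖r.denom.eval a‖ := by
  rw [closedDisk, toSphere_coe_mem_image_iff, mem_closedBall_zero_iff, norm_div]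
  constructor
  · rintro ⟨h1, h2⟩
    exact (div_le_one (norm_pos_iff.mpr h1)).mp h2
  · intro h
    have h1 := denom_ne_zero_of_norm_le r a h
    exact ⟨h1, (div_le_one (norm_pos_iff.mpr h1)).mpr h⟩

theorem toSphere_coe_mem_unitCircle_iff :
    toSphere r a ∈ unitCircle ↔ ‖r.num.eval a‖ = ‖r.denom.eval a‖ := by
  rw [unitCircle, toSphere_coe_mem_image_iff, mem_sphere_zero_iff_norm, norm_div]
  constructor
  · rintro ⟨h1, h2⟩
    exact (div_eq_one_iff_eq (norm_ne_zero_iff.mpr h1)).mp h2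
  · intro h
    have h1 := denom_ne_zero_of_norm_le r a h.le
    exact ⟨h1, (div_eq_one_iff_eq (norm_ne_zero_iff.mpr h1)).mpr h⟩

theorem toSphere_coe_mem_diskStar_iff :
    toSphere r a ∈ diskStar ↔ ‖r.denom.eval a‖ < ‖r.num.eval a‖ := by
  rw [diskStar, Set.mem_compl_iff, toSphere_coe_mem_closedDisk_iff, not_le]

end membership

section infinity

variable {r : RatFunc ℂ} (hdeg : 1 ≤ degree r) (hinf : toSphere r OnePoint.infty ∈ diskStar)

include hinf

theorem infinity_cases : (r.denom.natDegree < r.num.natDegree ∧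
      toSphere r OnePoint.infty = OnePoint.infty) ∨
    (r.denom.natDegree = r.num.natDegree ∧ 1 < ‖r.num.leadingCoeff‖ ∧
      toSphere r OnePoint.infty = ((r.num.leadingCoeff : ℂ) : OnePoint ℂ)) := by
  by_cases h : r.denom.natDegree < r.num.natDegree
  · exact Or.inl ⟨h, if_pos h⟩
  · have e : toSphere r OnePoint.infty =
        ((r.num.coeff r.denom.natDegree : ℂ) : OnePoint ℂ) := if_neg h
    have h1 : 1 < ‖r.num.coeff r.denom.natDegree‖ := by
      rw [e, diskStar, Set.mem_compl_iff, closedDisk] at hinf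
      by_contra hle
      exact hinf ⟨_, by simpa using hle, rfl⟩
    have h2 : r.denom.natDegree = r.num.natDegree := by
      refine le_antisymm ?_ (not_lt.mp h)
      apply le_natDegree_of_ne_zero
      intro h0
      rw [h0, norm_zero] at h1
      linarith
    rw [h2] at h1 e
    exact Or.inr ⟨h2, h1, e⟩

theorem degree_eq_natDegree_num : degree r = r.num.natDegree := by
  rcases infinity_cases hinf with ⟨h, -⟩ | ⟨h, -⟩
  · exact max_eq_left h.le
  · exact max_eq_left h.le

theorem norm_coeff_denom_lt : ‖r.denom.coeff r.num.natDegree‖ < ‖r.num.coeff r.num.natDegree‖ := by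
  rcases infinity_cases hinf with ⟨h, -⟩ | ⟨h, h1, -⟩
  · rw [coeff_eq_zero_of_natDegree_lt h, norm_zero, norm_pos_iff, coeff_natDegree,
      leadingCoeff_ne_zero]
    rintro h0
    simp [h0] at h
  · rw [← h, coeff_natDegree, r.monic_denom.leadingCoeff, norm_one, h]
    exact h1

theorem exists_eventually_norm_lt : ∃ ρ > (1 : ℝ), ∀ᶠ z in Bornology.cobounded ℂ,
    ρ * ‖r.denom.eval z‖ < ‖r.num.eval z‖ := by
  set k := r.num.natDegree
  have hqk : r.denom.natDegree ≤ k := by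
    rcases infinity_cases hinf with ⟨h, -⟩ | ⟨h, -⟩
    · exact h.le
    · exact h.le
  have hlt := norm_coeff_denom_lt hinf
  -- In the coordinate `1 / z` both polynomials become their reflections, whose values at 0 are the
  -- coefficients of degree `k`.
  have hrefl : ∀ u : ℂ[X], u.natDegree ≤ k → ∀ z : ℂ, z ≠ 0 →
      u.eval z = (reflect k u).eval z⁻¹ * z ^ k := by
    intro u hu z hz
    let _ := invertibleOfNonzero hz
    have := eval₂_reflect_mul_pow (RingHom.id ℂ) z k u hu
    rw [invOf_eq_inv] at this
    exact this.symm
  have hcoeff : ∀ u : ℂ[X], (reflect k u).eval 0 = u.coeff k := by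
    intro u
    rw [← coeff_zero_eq_eval_zero, coeff_reflect, revAt_zero]
  obtain ⟨ρ, hρ, hρlt⟩ : ∃ ρ > (1 : ℝ), ρ * ‖r.denom.coeff k‖ < ‖r.num.coeff k‖ := by
    have hc : Tendsto (fun ρ : ℝ => ρ * ‖r.denom.coeff k‖) (𝓝[>] 1) (𝓝 (1 * ‖r.denom.coeff k‖)) :=
      ((continuous_mul_const _).tendsto 1).mono_left nhdsWithin_le_nhds
    rw [one_mul] at hc
    obtain ⟨ρ, h1, h2⟩ := ((hc.eventually_lt_const hlt).and self_mem_nhdsWithin).exists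
    exact ⟨ρ, h2, h1⟩
  refine ⟨ρ, hρ, ?_⟩
  have hev : ∀ᶠ w in 𝓝 (0 : ℂ), ρ * ‖(reflect k r.denom).eval w‖ < ‖(reflect k r.num).eval w‖ := by
    refine ContinuousAt.eventually_lt
      (continuous_const.mul (reflect k r.denom).continuous.norm).continuousAt
      (reflect k r.num).continuous.norm.continuousAt ?_
    rw [hcoeff, hcoeff]
    exact hρlt
  have hinv : Tendsto (fun z : ℂ => z⁻¹) (Bornology.cobounded ℂ) (𝓝 0) := tendsto_inv₀_cobounded
  filter_upwards [hinv.eventually hev, Bornology.eventually_ne_cobounded (0 : ℂ)] with z hz hz0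
  rw [hrefl _ hqk z hz0, hrefl _ le_rfl z hz0, norm_mul, norm_mul, ← mul_assoc]
  exact mul_lt_mul_of_pos_right hz (norm_pos_iff.mpr (pow_ne_zero _ hz0))

include hdeg

/-- The multiplicity at infinity is exactly the amount by which the degree of the Wronskian falls
short of `2k - 2`. -/
theorem natDegree_wronskian_add_criticalMultiplicity :
    (wronskian r.num r.denom).natDegree + criticalMultiplicity r OnePoint.infty =
      2 * degree r - 2 := by
  have hW := wronskian_num_denom_ne_zero r hdeg
  have hk := degree_eq_natDegree_num hinf
  have hloc : localDegree r OnePoint.infty =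
      degree r - (fiberPoly r (toSphere r OnePoint.infty)).natDegree := rfl
  rw [criticalMultiplicity, hloc]
  rcases infinity_cases hinf with ⟨h, e⟩ | ⟨h, h1, e⟩
  · rw [e]
    have h2 := natDegree_wronskian_add_one hW h.ne'
    simp only [fiberPoly, OnePoint.elim_infty]
    omega
  · rw [e]
    simp only [fiberPoly, OnePoint.elim_some]
    -- Subtracting the value at infinity times the denominator keeps the Wronskian and lowers the
    -- degree, so the degree formula for unequal degrees applies.
    set g := r.num - C r.num.leadingCoeff * r.denom with hg
    have hWg : wronskian g r.denom = wronskian r.num r.denom := wronskian_sub_C_mul _ _ _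
    have hlt : g.natDegree < r.num.natDegree := by
      have hle : g.natDegree ≤ r.num.natDegree :=
        (natDegree_sub_le _ _).trans (max_le le_rfl ((natDegree_C_mul_le _ _).trans h.le))
      refine lt_of_le_of_ne hle fun heq => ?_
      have h0 : g.coeff r.num.natDegree = 0 := by
        have hlc : r.denom.coeff r.num.natDegree = 1 := by
          rw [← h, coeff_natDegree]
          exact r.monic_denom
        rw [hg, coeff_sub, coeff_C_mul, hlc, mul_one, coeff_natDegree, sub_self]
      rw [← heq, coeff_natDegree, leadingCoeff_eq_zero] at h0
      rw [← hWg, h0] at hW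
      simp at hW
    have h2 := natDegree_wronskian_add_one (g := g) (s := r.denom) (by rw [hWg]; exact hW)
      (by rw [h]; exact hlt.ne)
    rw [hWg] at h2
    omega

end infinity

section count

variable {r : RatFunc ℂ} (hdeg : 1 ≤ degree r)

include hdeg

/-- The Wronskian is unchanged when `p` is replaced by `p - w q`, and only changes sign when `p` and
`q` are swapped, which settles the poles. -/
theorem criticalMultiplicity_coe (a : ℂ) :
    criticalMultiplicity r a = (wronskian r.num r.denom).rootMultiplicity a := by
  have hW := wronskian_num_denom_ne_zero r hdeg
  have hcop := RatFunc.isCoprime_num_denom r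
  have hloc : localDegree r a = (fiberPoly r (toSphere r a)).rootMultiplicity a := rfl
  rw [criticalMultiplicity, hloc]
  by_cases h : r.denom.eval a = 0
  · rw [toSphere_coe_of_eq_zero r a h]
    simp only [fiberPoly, OnePoint.elim_infty]
    have hp : r.num.eval a ≠ 0 := fun hp => eval_ne_zero_or_of_isCoprime hcop hp h
    rw [← wronskian_neg_eq r.denom r.num] at hW ⊢
    rw [← rootMultiplicity_wronskian h hp (neg_ne_zero.mp hW), ← neg_one_mul,
      rootMultiplicity_mul (by rwa [neg_one_mul])]
    have : (-1 : ℂ[X]) = C (-1) := by simp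
    rw [this, rootMultiplicity_C, zero_add]
  · rw [toSphere_coe_of_ne_zero r a h]
    simp only [fiberPoly, OnePoint.elim_some]
    rw [← wronskian_sub_C_mul _ _ (r.num.eval a / r.denom.eval a)] at hW ⊢
    refine (rootMultiplicity_wronskian ?_ h hW).symm
    simp only [eval_sub, eval_mul, eval_C]
    rw [div_mul_cancel₀ _ h, sub_self]

open Classical in
theorem finsum_criticalMultiplicity_coe (s : Set ℂ) :
    ∑ᶠ z ∈ ((↑) : ℂ → OnePoint ℂ) '' s, criticalMultiplicity r z =
      ((wronskian r.num r.denom).roots.filter (· ∈ s)).card := by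
  have hW := wronskian_num_denom_ne_zero r hdeg
  rw [finsum_mem_image OnePoint.coe_injective.injOn]
  simp only [criticalMultiplicity_coe hdeg]
  rw [← Multiset.toFinset_sum_count_eq]
  have : s ∩ Function.support (fun a => (wronskian r.num r.denom).rootMultiplicity a) =
      ↑((wronskian r.num r.denom).roots.filter (· ∈ s)).toFinset ∩
        Function.support (fun a => (wronskian r.num r.denom).rootMultiplicity a) := by
    ext a
    simp only [Set.mem_inter_iff, Function.mem_support, Finset.mem_coe, Multiset.mem_toFinset,
      Multiset.mem_filter, ← count_roots, Multiset.count_ne_zero]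
    tauto
  rw [finsum_mem_eq_sum_of_inter_support_eq _ this]
  refine Finset.sum_congr rfl fun a ha => ?_
  rw [Multiset.mem_toFinset, Multiset.mem_filter] at ha
  rw [Multiset.count_filter_of_pos ha.2, count_roots]

variable (hinf : toSphere r OnePoint.infty ∈ diskStar)

include hinf

open Classical in
theorem criticalValueCount_disk : criticalValueCount r disk =
    ((wronskian r.num r.denom).roots.filter
      fun a => ‖r.num.eval a‖ < ‖r.denom.eval a‖).card := by
  have : toSphere r ⁻¹' disk = ((↑) : ℂ → OnePoint ℂ) ''
      {a | ‖r.num.eval a‖ < ‖r.denom.eval a‖} := by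
    ext z
    induction z using OnePoint.rec with
    | infty =>
      simp only [Set.mem_preimage, Set.mem_image, OnePoint.coe_ne_infty, and_false, exists_false,
        iff_false]
      exact fun hd => hinf (Set.image_mono ball_subset_closedBall hd)
    | coe a => simp [toSphere_coe_mem_disk_iff]
  rw [criticalValueCount, this, finsum_criticalMultiplicity_coe hdeg]
  rfl

open Classical in
theorem criticalValueCount_diskStar : criticalValueCount r diskStar =
    ((wronskian r.num r.denom).roots.filter
      fun a => ‖r.denom.eval a‖ < ‖r.num.eval a‖).card +
      criticalMultiplicity r OnePoint.infty := by
  have : toSphere r ⁻¹' diskStar = insert OnePoint.infty (((↑) : ℂ → OnePoint ℂ) ''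
      {a | ‖r.denom.eval a‖ < ‖r.num.eval a‖}) := by
    ext z
    induction z using OnePoint.rec with
    | infty => simpa using hinf
    | coe a => simp [toSphere_coe_mem_diskStar_iff]
  rw [criticalValueCount, this, finsum_mem_insert' _ (by simp)
    ((finite_criticalPoints r hdeg).subset Set.inter_subset_right),
    finsum_criticalMultiplicity_coe hdeg, add_comm]
  rfl

open Classical in
/-- The number of all critical values, counted with multiplicity, is `2 * degree r - 2`. -/
theorem criticalValueCount_add : criticalValueCount r disk + criticalValueCount r diskStar +
    ((wronskian r.num r.denom).roots.filter
      fun a => ‖r.num.eval a‖ = ‖r.denom.eval a‖).card = 2 * degree r - 2 := by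
  rw [criticalValueCount_disk hdeg hinf, criticalValueCount_diskStar hdeg hinf,
    ← natDegree_wronskian_add_criticalMultiplicity hdeg hinf,
    ← IsAlgClosed.card_roots_eq_natDegree]
  have : ∀ s : Multiset ℂ, (s.filter fun a => ‖r.num.eval a‖ < ‖r.denom.eval a‖).card +
      (s.filter fun a => ‖r.denom.eval a‖ < ‖r.num.eval a‖).card +
      (s.filter fun a => ‖r.num.eval a‖ = ‖r.denom.eval a‖).card = s.card := by
    intro s
    induction s using Multiset.induction_on with
    | empty => simp
    | cons a s ih =>
      rcases lt_trichotomy ‖r.num.eval a‖ ‖r.denom.eval a‖ with h | h | h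
      · simp [h, h.not_gt, h.ne]
        omega
      · simp [h]
        omega
      · simp [h, h.not_gt, h.ne']
        omega
  have := this (wronskian r.num r.denom).roots
  omega

end count

/-! ### An analytic Jordan lemniscate has no critical points -/

/-- A holomorphic function which near `0` is real exactly on the real line is locally injective. -/
theorem deriv_ne_zero_of_im_eq_zero_iff {H : ℂ → ℂ} (hH : AnalyticAt ℂ H 0) (h0 : H 0 = 0)
    (hre : ∀ᶠ s in 𝓝 (0 : ℂ), ((H s).im = 0 ↔ s.im = 0)) : deriv H 0 ≠ 0 := by
  have hnz : ¬ ∀ᶠ s in 𝓝 (0 : ℂ), H s = 0 := by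
    intro hz
    have h1 : ∀ᶠ s in 𝓝 (0 : ℂ), s.im = 0 := by
      filter_upwards [hz, hre] with s hs hs'
      exact hs'.mp (by rw [hs, Complex.zero_im])
    have hc : Tendsto (fun t : ℝ => (t : ℂ) * Complex.I) (𝓝[>] 0) (𝓝 0) := by
      have : Continuous fun t : ℝ => (t : ℂ) * Complex.I := by fun_prop
      simpa using (this.tendsto 0).mono_left nhdsWithin_le_nhds
    obtain ⟨t, ht, ht'⟩ := ((hc.eventually h1).and self_mem_nhdsWithin).exists
    simp at ht
    exact (ne_of_gt ht') ht
  obtain ⟨n, g, hg, hg0, hgH⟩ := hH.exists_eventuallyEq_pow_smul_nonzero_iff.mpr hnz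
  simp only [sub_zero, smul_eq_mul] at hgH
  have hgc := hg.continuousAt
  rcases Nat.lt_or_ge n 2 with hn | hn
  · interval_cases n
    · have := hgH.self_of_nhds
      rw [h0] at this
      simp at this
      exact absurd this.symm hg0
    · have hd : HasDerivAt (fun z => z ^ 1 * g z) (g 0) 0 := by
        have := ((hasDerivAt_id (0 : ℂ)).fun_mul hg.differentiableAt.hasDerivAt)
        simpa using this
      rw [(hd.congr_of_eventuallyEq hgH).deriv]
      exact hg0
  exfalso
  have hray : ∀ θ : ℝ, Tendsto (fun t : ℝ => (t : ℂ) * Complex.exp (θ * Complex.I)) (𝓝[>] 0)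
      (𝓝 0) := by
    intro θ
    have : Continuous fun t : ℝ => (t : ℂ) * Complex.exp (θ * Complex.I) := by fun_prop
    simpa using (this.tendsto 0).mono_left nhdsWithin_le_nhds
  have hlim : ∀ θ : ℝ, Tendsto (fun t : ℝ => (Complex.exp (n * (θ * Complex.I)) *
      g (t * Complex.exp (θ * Complex.I))).im) (𝓝[>] 0)
      (𝓝 (Complex.exp (n * (θ * Complex.I)) * g 0).im) := by
    intro θ
    have h1 : Tendsto (fun t : ℝ => g (t * Complex.exp (θ * Complex.I))) (𝓝[>] 0) (𝓝 (g 0)) :=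
      hgc.tendsto.comp (hray θ)
    exact (Complex.continuous_im.tendsto _).comp (h1.const_mul _)
  have heq : ∀ θ : ℝ, ∀ᶠ t : ℝ in 𝓝[>] 0, (H (t * Complex.exp (θ * Complex.I))).im =
      t ^ n * (Complex.exp (n * (θ * Complex.I)) * g (t * Complex.exp (θ * Complex.I))).im := by
    intro θ
    filter_upwards [(hray θ).eventually hgH] with t ht
    rw [ht, mul_pow, ← Complex.exp_nat_mul, mul_assoc, ← Complex.ofReal_pow, Complex.im_ofReal_mul]
  have hpos : ∀ᶠ t : ℝ in 𝓝[>] 0, 0 < t := self_mem_nhdsWithin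
  -- Along the positive real axis `H` is real, hence so is the leading coefficient `g 0`.
  have hreal : (g 0).im = 0 := by
    have h1 : ∀ᶠ t : ℝ in 𝓝[>] 0, (Complex.exp (n * ((0 : ℝ) * Complex.I)) *
        g (t * Complex.exp ((0 : ℝ) * Complex.I))).im = 0 := by
      filter_upwards [heq 0, (hray 0).eventually hre, hpos] with t h1 h2 h3
      rw [h1] at h2
      have : t ^ n * (Complex.exp (n * ((0 : ℝ) * Complex.I)) *
        g (t * Complex.exp ((0 : ℝ) * Complex.I))).im = 0 := h2.mpr (by simp)
      exact (mul_eq_zero.mp this).resolve_left (pow_ne_zero _ h3.ne')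
    have h2 := tendsto_nhds_unique (hlim 0) (tendsto_const_nhds.congr' (h1.mono fun t ht => ht.symm))
    simpa using h2
  have hre0 : (g 0).re ≠ 0 := fun h => hg0 (Complex.ext h hreal)
  have hnC : (n : ℂ) ≠ 0 := Nat.cast_ne_zero.mpr (by omega)
  have hnR : (0 : ℝ) < n := Nat.cast_pos.mpr (by omega)
  have hnR2 : (2 : ℝ) ≤ n := by exact_mod_cast hn
  have hpi := Real.pi_pos
  -- If the order `n` is at least 2, the rays at angles `π / (2n)` and `3π / (2n)` both lie in the
  -- upper half plane, and the imaginary part of `H` has opposite signs on them. It therefore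
  -- vanishes somewhere off the real line.
  have e1 : (Complex.exp (n * (((Real.pi / (2 * n) : ℝ) : ℂ) * Complex.I)) * g 0).im =
      (g 0).re := by
    have : n * (((Real.pi / (2 * n) : ℝ) : ℂ) * Complex.I) = Real.pi / 2 * Complex.I := by
      push_cast
      field_simp
    rw [this, Complex.exp_pi_div_two_mul_I]
    simp
  have e2 : (Complex.exp (n * (((3 * Real.pi / (2 * n) : ℝ) : ℂ) * Complex.I)) * g 0).im =
      -(g 0).re := by
    have : n * (((3 * Real.pi / (2 * n) : ℝ) : ℂ) * Complex.I) =
        Real.pi * Complex.I + Real.pi / 2 * Complex.I := by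
      push_cast
      field_simp
      ring
    rw [this, Complex.exp_add, Complex.exp_pi_mul_I, Complex.exp_pi_div_two_mul_I]
    simp
  obtain ⟨ε, hε, hball⟩ := Metric.eventually_nhds_iff_ball.mp (hre.and hH.eventually_analyticAt)
  have hbound : ∀ θ : ℝ, ∀ᶠ t : ℝ in 𝓝[>] 0,
      (t : ℂ) * Complex.exp (θ * Complex.I) ∈ ball (0 : ℂ) ε :=
    fun θ => (hray θ).eventually (ball_mem_nhds _ hε)
  have hprod : ∀ᶠ t : ℝ in 𝓝[>] 0,
      (Complex.exp (n * (((Real.pi / (2 * n) : ℝ) : ℂ) * Complex.I)) *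
        g (t * Complex.exp (((Real.pi / (2 * n) : ℝ) : ℂ) * Complex.I))).im *
      (Complex.exp (n * (((3 * Real.pi / (2 * n) : ℝ) : ℂ) * Complex.I)) *
        g (t * Complex.exp (((3 * Real.pi / (2 * n) : ℝ) : ℂ) * Complex.I))).im < 0 := by
    refine ((hlim _).mul (hlim _)).eventually_lt_const ?_
    rw [e1, e2, mul_neg, neg_lt_zero]
    exact mul_self_pos.mpr hre0
  obtain ⟨t, ⟨⟨⟨⟨⟨h1, h2⟩, h3⟩, h4⟩, h5⟩, h6⟩⟩ := (((((hprod.and (heq (Real.pi / (2 * n)))).and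
    (heq (3 * Real.pi / (2 * n)))).and (hbound (Real.pi / (2 * n)))).and
    (hbound (3 * Real.pi / (2 * n)))).and hpos).exists
  set s₁ := (t : ℂ) * Complex.exp (((Real.pi / (2 * n) : ℝ) : ℂ) * Complex.I)
  set s₂ := (t : ℂ) * Complex.exp (((3 * Real.pi / (2 * n) : ℝ) : ℂ) * Complex.I)
  have him : ∀ θ : ℝ, 0 < θ → θ < Real.pi → 0 < ((t : ℂ) * Complex.exp (θ * Complex.I)).im := by
    intro θ ha hb
    rw [Complex.im_ofReal_mul, Complex.exp_ofReal_mul_I_im]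
    exact mul_pos h6 (Real.sin_pos_of_pos_of_lt_pi ha hb)
  have hs1 : 0 < s₁.im := by
    refine him _ (by positivity) ?_
    rw [div_lt_iff₀ (by positivity)]
    nlinarith
  have hs2 : 0 < s₂.im := by
    refine him _ (by positivity) ?_
    rw [div_lt_iff₀ (by positivity)]
    nlinarith
  have hpre : IsPreconnected (ball (0 : ℂ) ε ∩ {s | 0 < s.im}) :=
    ((convex_ball _ _).inter (convex_halfSpace_im_gt 0)).isPreconnected
  have hcont : ContinuousOn (fun s => (H s).im) (ball (0 : ℂ) ε ∩ {s | 0 < s.im}) := fun s hs =>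
    (Complex.continuous_im.continuousAt.comp
      (hball s hs.1).2.continuousAt).continuousWithinAt
  have hneg : (H s₁).im * (H s₂).im < 0 := by
    rw [h2, h3]
    have : 0 < t ^ n := pow_pos h6 n
    nlinarith [mul_pos this this]
  have hzero : (0 : ℝ) ∈ (fun s => (H s).im) '' (ball (0 : ℂ) ε ∩ {s | 0 < s.im}) := by
    rcases mul_neg_iff.mp hneg with ⟨ha, hb⟩ | ⟨ha, hb⟩
    · exact hpre.intermediate_value ⟨h5, hs2⟩ ⟨h4, hs1⟩ hcont ⟨hb.le, ha.le⟩
    · exact hpre.intermediate_value ⟨h4, hs1⟩ ⟨h5, hs2⟩ hcont ⟨ha.le, hb.le⟩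
  obtain ⟨s, ⟨hs, hs'⟩, hs0⟩ := hzero
  exact (ne_of_gt hs') ((hball s hs).1.mp hs0)

/-- A lemniscate that is an analytic Jordan curve contains no critical points. -/
theorem wronskian_ne_zero_of_isAnalyticJordanCurve {p q : ℂ[X]} (h : IsCoprime p q)
    (hL : IsAnalyticJordanCurve {z | ‖p.eval z‖ = ‖q.eval z‖}) {x : ℂ}
    (hx : ‖p.eval x‖ = ‖q.eval x‖) : (wronskian p q).eval x ≠ 0 := by
  obtain ⟨f, U, hU, hsU, hf, hinj, hfL⟩ := hL
  have hx' : x ∈ f '' sphere (0 : ℂ) 1 := by rw [hfL]; exact hx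
  obtain ⟨z₀, hz₀, rfl⟩ := hx'
  have hz₀1 : ‖z₀‖ = 1 := mem_sphere_zero_iff_norm.mp hz₀
  have hz₀0 : z₀ ≠ 0 := norm_ne_zero_iff.mp (by rw [hz₀1]; exact one_ne_zero)
  have hq0 : q.eval (f z₀) ≠ 0 := by
    intro h0
    rw [h0, norm_zero, norm_eq_zero] at hx
    exact eval_ne_zero_or_of_isCoprime h hx h0
  intro hW
  set r₀ := p.eval (f z₀) / q.eval (f z₀) with hr₀
  have hr₀1 : ‖r₀‖ = 1 := by
    rw [hr₀, norm_div, div_eq_one_iff_eq (norm_ne_zero_iff.mpr hq0)]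
    exact hx
  have hr₀0 : r₀ ≠ 0 := norm_ne_zero_iff.mp (by rw [hr₀1]; exact one_ne_zero)
  -- The map `e` straightens the circle at `z₀` to the real line.
  let e : ℂ → ℂ := fun s => z₀ * Complex.exp (s * Complex.I)
  have he0 : e 0 = z₀ := by simp [e]
  have hea : AnalyticAt ℂ e 0 := by
    have : Differentiable ℂ e := by fun_prop
    exact this.analyticAt 0
  have hfa : AnalyticAt ℂ f (e 0) := by
    rw [he0]
    exact hf.analyticAt (hU.mem_nhds (hsU hz₀))
  have hfe : AnalyticAt ℂ (fun s => f (e s)) 0 := hfa.comp hea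
  have hpoly : ∀ u : ℂ[X], AnalyticAt ℂ (fun s => u.eval (f (e s))) 0 := fun u =>
    AnalyticAt.comp (g := fun z => u.eval z) (u.differentiable.analyticAt _) hfe
  have hqe : q.eval (f (e 0)) ≠ 0 := by rwa [he0]
  have hR : AnalyticAt ℂ (fun s => p.eval (f (e s)) / q.eval (f (e s)) / r₀) 0 :=
    ((hpoly p).div (hpoly q) hqe).div analyticAt_const hr₀0
  have hR0 : p.eval (f (e 0)) / q.eval (f (e 0)) / r₀ = 1 := by
    rw [he0]
    exact div_self hr₀0
  -- This is `-i log (r / r₀)` in the coordinate `s`; it is real exactly where `|r| = 1`, and its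
  -- derivative vanishes at a critical point.
  let H : ℂ → ℂ := fun s =>
    Complex.log (p.eval (f (e s)) / q.eval (f (e s)) / r₀) * (-Complex.I)
  have hH : AnalyticAt ℂ H 0 :=
    (hR.clog (by rw [hR0]; exact Complex.one_mem_slitPlane)).mul analyticAt_const
  have hH0 : H 0 = 0 := by simp only [H, hR0, Complex.log_one, zero_mul]
  have hcq : ∀ᶠ s in 𝓝 (0 : ℂ), q.eval (f (e s)) ≠ 0 :=
    (hpoly q).continuousAt.eventually_ne hqe
  have hcp : ∀ᶠ s in 𝓝 (0 : ℂ), p.eval (f (e s)) ≠ 0 := by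
    refine (hpoly p).continuousAt.eventually_ne ?_
    rw [he0]
    intro h0
    exact hr₀0 (by rw [hr₀, h0, zero_div])
  have hcU : ∀ᶠ s in 𝓝 (0 : ℂ), e s ∈ U :=
    hea.continuousAt.eventually_mem (hU.mem_nhds (by rw [he0]; exact hsU hz₀))
  refine deriv_ne_zero_of_im_eq_zero_iff hH hH0 ?_ ?_
  · filter_upwards [hcq, hcp, hcU] with s h1 h2 h3
    have hnorm : ‖e s‖ = Real.exp (-s.im) := by
      simp [e, hz₀1, Complex.norm_exp]
    have i1 : s.im = 0 ↔ e s ∈ sphere (0 : ℂ) 1 := by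
      rw [mem_sphere_zero_iff_norm, hnorm, Real.exp_eq_one_iff, neg_eq_zero]
    have i2 : (H s).im = 0 ↔ ‖p.eval (f (e s))‖ = ‖q.eval (f (e s))‖ := by
      have hpos : 0 < ‖p.eval (f (e s))‖ / ‖q.eval (f (e s))‖ :=
        div_pos (norm_pos_iff.mpr h2) (norm_pos_iff.mpr h1)
      have : (H s).im = -Real.log (‖p.eval (f (e s))‖ / ‖q.eval (f (e s))‖) := by
        simp [H, Complex.log_re, hr₀1]
      rw [this, neg_eq_zero, ← Real.log_one, Real.log_injOn_pos.eq_iff hpos (Set.mem_Ioi.mpr one_pos),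
        div_eq_one_iff_eq (norm_ne_zero_iff.mpr h1)]
    rw [i1, i2, ← hinj.mem_image_iff hsU h3, hfL]
    rfl
  · have hd1 : HasDerivAt (fun z => p.eval z / q.eval z) 0 (f (e 0)) := by
      have := (hasStrictDerivAt_div (p := p) (q := q) hqe).hasDerivAt
      rw [he0, hW, neg_zero, zero_div] at this
      rwa [he0]
    have hd2 : HasDerivAt (fun s => p.eval (f (e s)) / q.eval (f (e s))) 0 0 := by
      have := hd1.comp (0 : ℂ) hfe.differentiableAt.hasDerivAt
      rwa [zero_mul] at this
    have hd3 := ((hd2.div_const r₀).clog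
      (by rw [hR0]; exact Complex.one_mem_slitPlane)).mul_const (-Complex.I)
    simp only [zero_div, zero_mul] at hd3
    exact hd3.deriv

/-! ### Components of complements and the maximum principle -/

/-- A frontier point in `F` would have an open component meeting the given one, hence equal to it;
but an open set contains none of its frontier. -/
theorem frontier_connectedComponentIn_subset {X : Type*} [TopologicalSpace X]
    [LocallyConnectedSpace X] {F : Set X} (hF : IsOpen F) (x : X) :
    frontier (connectedComponentIn F x) ⊆ Fᶜ := by
  intro y hy hyF
  rw [hF.connectedComponentIn.frontier_eq] at hy
  obtain ⟨z, hz1, hz2⟩ := mem_closure_iff.mp hy.1 _ hF.connectedComponentIn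
    (mem_connectedComponentIn hyF)
  apply hy.2
  rw [connectedComponentIn_eq hz2, ← connectedComponentIn_eq hz1]
  exact mem_connectedComponentIn hyF

theorem norm_eval_le_of_frontier {p q : ℂ[X]} {U : Set ℂ} (hU : Bornology.IsBounded U)
    (hq : ∀ z ∈ closure U, q.eval z ≠ 0) (h : ∀ z ∈ frontier U, ‖p.eval z‖ ≤ ‖q.eval z‖) :
    ∀ z ∈ closure U, ‖p.eval z‖ ≤ ‖q.eval z‖ := by
  intro z hz
  have hd : DifferentiableOn ℂ (fun z => p.eval z / q.eval z) (closure U) :=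
    p.differentiable.differentiableOn.div q.differentiable.differentiableOn hq
  have key := Complex.norm_le_of_forall_mem_frontier_norm_le hU hd.diffContOnCl (C := 1)
    (fun w hw => ?_) hz
  · rwa [norm_div, div_le_one (norm_pos_iff.mpr (hq z hz))] at key
  · rw [norm_div, div_le_one (norm_pos_iff.mpr (hq w (frontier_subset_closure hw)))]
    exact h w hw

theorem isOpen_norm_lt (p q : ℂ[X]) : IsOpen {z | ‖p.eval z‖ < ‖q.eval z‖} :=
  isOpen_lt p.continuous.norm q.continuous.norm

theorem IsJordanCurve.isCompact {Γ : Set ℂ} (h : IsJordanCurve Γ) : IsCompact Γ := by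
  obtain ⟨γ, h1, -, rfl⟩ := h
  exact isCompact_range h1

theorem IsJordanCurve.isConnected {Γ : Set ℂ} (h : IsJordanCurve Γ) : IsConnected Γ := by
  obtain ⟨γ, h1, -, rfl⟩ := h
  have : ConnectedSpace Circle := by
    have := Circle.exp.continuous
    refine Function.Surjective.connectedSpace (f := fun t : ℝ => Circle.exp t) ?_ this
    exact fun z => ⟨_, Circle.exp_arg z⟩
  exact isConnected_range h1

theorem IsAnalyticJordanCurve.isJordanCurve {Γ : Set ℂ} (h : IsAnalyticJordanCurve Γ) :
    IsJordanCurve Γ := by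
  obtain ⟨f, U, hU, hs, hf, hinj, rfl⟩ := h
  have hmem : ∀ z : Circle, (z : ℂ) ∈ sphere (0 : ℂ) 1 := fun z =>
    mem_sphere_zero_iff_norm.mpr (Circle.norm_coe z)
  refine ⟨fun z => f z, hf.continuousOn.comp_continuous continuous_subtype_val
    fun z => hs (hmem z), fun z w hzw => ?_, ?_⟩
  · exact Subtype.ext (hinj (hs (hmem z)) (hs (hmem w)) hzw)
  · ext x
    constructor
    · rintro ⟨z, rfl⟩
      exact ⟨z, hmem z, rfl⟩
    · rintro ⟨z, hz, rfl⟩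
      exact ⟨⟨z, hz⟩, rfl⟩

/-- The exterior of `Γ` is disjoint from the bounded components of its complement. -/
theorem coe_notMem_outside {Γ : Set ℂ} (hΓ : IsCompact Γ) {z a : ℂ}
    (hb : Bornology.IsBounded (connectedComponentIn Γᶜ z)) (ha : a ∈ connectedComponentIn Γᶜ z) :
    (a : OnePoint ℂ) ∉ outside Γ := by
  set C := connectedComponentIn Γᶜ z
  have hCo : IsOpen C := hΓ.isClosed.isOpen_compl.connectedComponentIn
  have hU : IsOpen (((↑) : ℂ → OnePoint ℂ) '' C) := OnePoint.isOpen_image_coe.mpr hCo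
  have hV : IsOpen (((↑) : ℂ → OnePoint ℂ) '' closure C)ᶜ :=
    OnePoint.isOpen_compl_image_coe.mpr ⟨isClosed_closure, hb.isCompact_closure⟩
  have hinfty : OnePoint.infty ∈ (((↑) : ℂ → OnePoint ℂ) '' Γ)ᶜ := OnePoint.infty_notMem_image_coe
  -- The frontier of `C` lies in `Γ`, so off `Γ` the sphere splits into the open sets `C` and the
  -- complement of its closure; the latter contains `∞`.
  have hsub : outside Γ ⊆ (((↑) : ℂ → OnePoint ℂ) '' closure C)ᶜ := by
    refine isPreconnected_connectedComponentIn.subset_left_of_subset_union hV hU ?_ ?_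
      ⟨OnePoint.infty, mem_connectedComponentIn hinfty, OnePoint.infty_notMem_image_coe⟩
    · rw [Set.disjoint_compl_left_iff_subset]
      exact Set.image_mono subset_closure
    · intro x hx
      have hx' := connectedComponentIn_subset _ _ hx
      by_cases hxc : x ∈ ((↑) : ℂ → OnePoint ℂ) '' closure C
      · obtain ⟨y, hy, rfl⟩ := hxc
        by_cases hyC : y ∈ C
        · exact Or.inr ⟨y, hyC, rfl⟩
        · exfalso
          have hyf : y ∈ frontier C := by
            rw [hCo.frontier_eq]
            exact ⟨hy, hyC⟩
          exact hx' ⟨y, not_not.mp (frontier_connectedComponentIn_subset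
            hΓ.isClosed.isOpen_compl z hyf), rfl⟩
      · exact Or.inl hxc
  exact fun h => hsub h ⟨a, subset_closure ha, rfl⟩

namespace Decomposition

variable {p q : ℂ[X]} (D : Decomposition p q) (h : IsCoprime p q)
  (hinf : ∀ᶠ z in Bornology.cobounded ℂ, ‖q.eval z‖ < ‖p.eval z‖)

/-- The winding number of the `i`-th curve, extended to the curve by its value on the side where
`|p| < |q|`. -/
def innerIndex (i : D.ι) (a : ℂ) : ℤ :=
  open Classical in D.index h i a + if a ∈ D.f i '' sphere 0 1 then 1 else 0

theorem innerIndex_of_ne (i : D.ι) {a : ℂ} (ha : ‖p.eval a‖ ≠ ‖q.eval a‖) :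
    D.innerIndex h i a = D.index h i a := by
  rw [innerIndex, if_neg fun hi => ha (D.curve_subset i hi), add_zero]

theorem innerIndex_apply (i : D.ι) {w : ℂ} (hw : w ∈ annulus D.R) (hw1 : ‖w‖ ≤ 1) :
    D.innerIndex h i (D.f i w) = D.ν h i + 1 := by
  have hiff : D.f i w ∈ D.f i '' sphere 0 1 ↔ ‖w‖ = 1 := by
    rw [(D.injOn i).mem_image_iff (sphere_subset_annulus D.one_lt) hw, mem_sphere_zero_iff_norm]
  rw [innerIndex, D.index_apply h i hw, hiff]
  rcases hw1.lt_or_eq with h1 | h1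
  · simp [h1, h1.ne]
  · simp [h1]

/-- Near the curve only the inner collar belongs to `|p| ≤ |q|`, and the index there is `ν + 1`.
Hence this index is constant on connected subsets of `|p| ≤ |q|`. -/
theorem continuousOn_innerIndex (i : D.ι) :
    ContinuousOn (D.innerIndex h i) {z | ‖p.eval z‖ ≤ ‖q.eval z‖} := by
  intro a ha
  have key : ∀ᶠ b in 𝓝[{z | ‖p.eval z‖ ≤ ‖q.eval z‖}] a,
      D.innerIndex h i b = D.innerIndex h i a := by
    by_cases hai : a ∈ D.f i '' sphere 0 1
    · obtain ⟨w, hw, rfl⟩ := hai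
      have hwA := sphere_subset_annulus D.one_lt hw
      have hn : D.f i '' annulus D.R ∈ 𝓝 (D.f i w) := by
        rw [← D.map_nhds_eq h i hwA]
        exact image_mem_map ((isOpen_annulus _).mem_nhds hwA)
      filter_upwards [nhdsWithin_le_nhds hn, self_mem_nhdsWithin] with b hb hb'
      obtain ⟨v, hv, rfl⟩ := hb
      rw [D.innerIndex_apply h i hwA (mem_sphere_zero_iff_norm.mp hw).le,
        D.innerIndex_apply h i hv (not_lt.mp fun hlt => ?_)]
      exact (not_lt.mpr hb') ((D.norm_gt_iff h i hv).mpr hlt)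
    · filter_upwards [nhdsWithin_le_nhds (D.eventually_index_eq h i hai),
        nhdsWithin_le_nhds ((D.isClosed_curve i).isOpen_compl.mem_nhds hai)] with b hb hb'
      rw [innerIndex, innerIndex, hb, if_neg hb', if_neg hai]
  exact tendsto_const_nhds.congr' (key.mono fun b hb => hb.symm)

theorem innerIndex_eq_of_isPreconnected (i : D.ι) {S : Set ℂ} (hS : IsPreconnected S)
    (hSs : S ⊆ {z | ‖p.eval z‖ ≤ ‖q.eval z‖}) {a b : ℂ} (ha : a ∈ S) (hb : b ∈ S) :
    D.innerIndex h i a = D.innerIndex h i b :=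
  hS.constant_of_mapsTo (T := Set.univ) IsDiscrete.univ ((D.continuousOn_innerIndex h i).mono hSs)
    (fun _ _ => Set.mem_univ _) ha hb

theorem exists_annulus_norm_lt_one : ∃ w ∈ annulus D.R, ‖w‖ < 1 := by
  have hR := D.one_lt
  have h1 : D.R⁻¹ < 1 := inv_lt_one_of_one_lt₀ hR
  have h0 : 0 < D.R⁻¹ := inv_pos.mpr (by linarith)
  have e : ‖(((D.R⁻¹ + 1) / 2 : ℝ) : ℂ)‖ = (D.R⁻¹ + 1) / 2 := by
    rw [Complex.norm_real, Real.norm_of_nonneg (by linarith)]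
  exact ⟨(((D.R⁻¹ + 1) / 2 : ℝ) : ℂ), ⟨by rw [e]; linarith, by rw [e]; linarith⟩,
    by rw [e]; linarith⟩

include hinf

theorem isBounded_norm_lt : Bornology.IsBounded {z | ‖p.eval z‖ < ‖q.eval z‖} := by
  rw [← Bornology.isCobounded_compl_iff]
  filter_upwards [hinf] with z hz
  exact not_lt.mpr hz.le

/-- Every component of `|p| < |q|` contains a zero of `p`. -/
theorem exists_root_innerIndex (i : D.ι) :
    ∃ z, p.eval z = 0 ∧ D.innerIndex h i z = D.ν h i + 1 := by
  obtain ⟨w, hw, hw1⟩ := D.exists_annulus_norm_lt_one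
  set Ω := {z | ‖p.eval z‖ < ‖q.eval z‖} with hΩ
  have hΩo : IsOpen Ω := isOpen_norm_lt p q
  have ha : D.f i w ∈ Ω := (D.norm_lt_iff h i hw).mpr hw1
  set C := connectedComponentIn Ω (D.f i w)
  have hCΩ : C ⊆ Ω := connectedComponentIn_subset _ _
  have haC : D.f i w ∈ C := mem_connectedComponentIn ha
  suffices ∃ z ∈ C, p.eval z = 0 by
    obtain ⟨z, hz, hz0⟩ := this
    refine ⟨z, hz0, ?_⟩
    rw [← D.innerIndex_apply h i hw hw1.le]
    exact D.innerIndex_eq_of_isPreconnected h i isPreconnected_connectedComponentIn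
      (hCΩ.trans fun x hx => le_of_lt (show ‖p.eval x‖ < ‖q.eval x‖ from hx)) hz haC
  -- Without a zero, the maximum principle for `q / p` would give `|q| ≤ |p|` on the component.
  by_contra! hno
  have hfr : ∀ z ∈ frontier C, ‖q.eval z‖ ≤ ‖p.eval z‖ := fun z hz =>
    not_lt.mp (frontier_connectedComponentIn_subset hΩo _ hz)
  have hp : ∀ z ∈ closure C, p.eval z ≠ 0 := by
    intro z hz hz0
    rw [closure_eq_self_union_frontier] at hz
    rcases hz with hz | hz
    · exact hno z hz hz0
    · have := hfr z hz
      rw [hz0, norm_zero, norm_le_zero_iff] at this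
      exact eval_ne_zero_or_of_isCoprime h hz0 this
  exact (not_lt.mpr (norm_eval_le_of_frontier ((isBounded_norm_lt hinf).subset hCΩ) hp hfr _
    (subset_closure haC))) ha

/-- If the zeros of `p` lie inside a Jordan curve in `|p| ≤ |q|` and those of `q` outside of it,
then exactly one curve of the decomposition has positive orientation. -/
theorem sum_ν_of_isJordanCurve {Γ : Set ℂ} (hΓ : IsJordanCurve Γ)
    (hp : ∀ z, p.eval z = 0 → z ∈ inside Γ)
    (hq : ∀ z : ℂ, q.eval z = 0 → (z : OnePoint ℂ) ∈ outside Γ)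
    (hΓle : ∀ z ∈ Γ, ‖p.eval z‖ ≤ ‖q.eval z‖) (hroot : ∃ z, p.eval z = 0) :
    ∑ i, D.ν h i = 1 - Fintype.card D.ι := by
  obtain ⟨γ₀, hγ₀⟩ := hΓ.isConnected.nonempty
  have hΓo : IsOpen Γᶜ := hΓ.isCompact.isClosed.isOpen_compl
  -- The component of a zero in the complement of `Γ` is bounded and free of poles, so its closure
  -- stays in `|p| ≤ |q|` and links the zero to `Γ`, which is itself connected.
  have hconst : ∀ i z, p.eval z = 0 → D.innerIndex h i z = D.innerIndex h i γ₀ := by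
    intro i z hz
    obtain ⟨hzΓ, hzb⟩ := hp z hz
    set C := connectedComponentIn Γᶜ z with hC
    have hzC : z ∈ C := mem_connectedComponentIn hzΓ
    have hfr : frontier C ⊆ Γ := fun y hy =>
      not_not.mp (frontier_connectedComponentIn_subset hΓo z hy)
    have hqC : ∀ y ∈ closure C, q.eval y ≠ 0 := by
      intro y hy hy0
      rw [closure_eq_self_union_frontier] at hy
      rcases hy with hy | hy
      · exact coe_notMem_outside hΓ.isCompact hzb hy (hq y hy0)
      · have := hΓle y (hfr hy)
        rw [hy0, norm_zero, norm_le_zero_iff] at this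
        exact eval_ne_zero_or_of_isCoprime h this hy0
    have hle := norm_eval_le_of_frontier hzb hqC fun y hy => hΓle y (hfr hy)
    obtain ⟨y, hy⟩ : (frontier C).Nonempty := by
      rw [nonempty_frontier_iff]
      refine ⟨⟨z, hzC⟩, fun hu => ?_⟩
      have : γ₀ ∈ C := by
        rw [hu]
        trivial
      exact connectedComponentIn_subset Γᶜ z this hγ₀
    rw [D.innerIndex_eq_of_isPreconnected h i
      (isPreconnected_connectedComponentIn.closure : IsPreconnected (closure C)) hle
      (subset_closure hzC) (frontier_subset_closure hy)]
    exact D.innerIndex_eq_of_isPreconnected h i hΓ.isConnected.isPreconnected hΓle (hfr hy) hγ₀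
  obtain ⟨z₁, hz₁⟩ := hroot
  have hlt : ‖p.eval z₁‖ < ‖q.eval z₁‖ := by
    rw [hz₁, norm_zero]
    exact norm_pos_iff.mpr fun hq => eval_ne_zero_or_of_isCoprime h hz₁ hq
  have hsum := D.sum_index h hinf z₁
  rw [if_pos hlt] at hsum
  have hν : ∀ i, D.index h i z₁ = D.ν h i + 1 := by
    intro i
    obtain ⟨z, hz0, hz⟩ := D.exists_root_innerIndex h hinf i
    rw [← hz, ← D.innerIndex_of_ne h i hlt.ne, hconst i z₁ hz₁, hconst i z hz0]
  simp only [hν, Finset.sum_add_distrib, Finset.sum_const, Finset.card_univ] at hsum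
  simp at hsum
  linarith

omit hinf

theorem card_eq_one_of_isConnected (hL : IsConnected {z | ‖p.eval z‖ = ‖q.eval z‖}) :
    Fintype.card D.ι = 1 := by
  classical
  rw [← D.iUnion_eq] at hL
  obtain ⟨x, hx⟩ := hL.nonempty
  obtain ⟨i, hi⟩ := Set.mem_iUnion.mp hx
  refine Fintype.card_eq_one_iff.mpr ⟨i, fun j => ?_⟩
  by_contra hj
  have hclosed : IsClosed (⋃ k ∈ {k | k ≠ i}, D.f k '' sphere 0 1) :=
    (Set.toFinite _).isClosed_biUnion fun k _ => D.isClosed_curve k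
  obtain ⟨w, hw⟩ : (sphere (0 : ℂ) 1).Nonempty := ⟨1, by simp⟩
  obtain ⟨y, -, hy1, hy2⟩ := isPreconnected_closed_iff.mp hL.isPreconnected _ _
    (D.isClosed_curve i) hclosed (fun y hy => by
      obtain ⟨k, hk⟩ := Set.mem_iUnion.mp hy
      by_cases hki : k = i
      · exact Or.inl (hki ▸ hk)
      · exact Or.inr (Set.mem_biUnion (show k ∈ {k | k ≠ i} from hki) hk))
    ⟨x, hx, hi⟩ ⟨D.f j w, Set.mem_iUnion.mpr ⟨j, w, hw, rfl⟩,
      Set.mem_biUnion (show j ∈ {k | k ≠ i} from hj) ⟨w, hw, rfl⟩⟩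
  obtain ⟨k, hk, hyk⟩ := Set.mem_iUnion₂.mp hy2
  exact Set.disjoint_left.mp (D.disjoint hk) hyk hy1

-- At a point of the inner collar the only index is `ν + 1`, and it must be 1.
include hinf in
theorem sum_ν_of_card_eq_one (hcard : Fintype.card D.ι = 1) : ∑ i, D.ν h i = 0 := by
  obtain ⟨i, hi⟩ := Fintype.card_eq_one_iff.mp hcard
  have hu : (Finset.univ : Finset D.ι) = {i} := by
    ext j
    simp [hi j]
  obtain ⟨w, hw, hw1⟩ := D.exists_annulus_norm_lt_one
  have hsum := D.sum_index h hinf (D.f i w)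
  rw [if_pos ((D.norm_lt_iff h i hw).mpr hw1), hu, Finset.sum_singleton, D.index_apply h i hw,
    if_pos hw1] at hsum
  rw [hu, Finset.sum_singleton]
  linarith

include h in
/-- If the lemniscate is a single curve then `|q| < |p|` is connected. -/
theorem isPreconnected_norm_gt (hcard : Fintype.card D.ι = 1) :
    IsPreconnected {z | ‖q.eval z‖ < ‖p.eval z‖} := by
  obtain ⟨i, hi⟩ := Fintype.card_eq_one_iff.mp hcard
  have hL : {z | ‖p.eval z‖ = ‖q.eval z‖} = D.f i '' sphere 0 1 := by
    rw [← D.iUnion_eq]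
    ext x
    rw [Set.mem_iUnion]
    exact ⟨fun ⟨j, hj⟩ => hi j ▸ hj, fun hx => ⟨i, hx⟩⟩
  set V := {z | ‖q.eval z‖ < ‖p.eval z‖} with hV
  have hVo : IsOpen V := isOpen_norm_lt q p
  have hR := D.one_lt
  set O := D.f i '' {z : ℂ | 1 < ‖z‖ ∧ ‖z‖ < D.R} with hO
  have hsub : {z : ℂ | 1 < ‖z‖ ∧ ‖z‖ < D.R} ⊆ annulus D.R := fun z hz =>
    ⟨(inv_lt_one_of_one_lt₀ hR).trans hz.1, hz.2⟩
  have hOpre : IsPreconnected O := (isPreconnected_norm_mem_Ioo one_pos (by linarith)).image _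
    ((D.differentiableOn i).continuousOn.mono hsub)
  have hOV : O ⊆ V := by
    rintro _ ⟨z, hz, rfl⟩
    exact (D.norm_gt_iff h i (hsub hz)).mpr hz.1
  -- A component of `|q| < |p|` has a frontier point, necessarily on the curve; near it the
  -- component meets the outer collar `O`, which is connected.
  have key : ∀ a ∈ V, O ⊆ connectedComponentIn V a := by
    intro a ha
    set C := connectedComponentIn V a
    have haC : a ∈ C := mem_connectedComponentIn ha
    obtain ⟨x, hx⟩ : (frontier C).Nonempty := by
      rw [nonempty_frontier_iff]
      refine ⟨⟨a, haC⟩, fun hu => ?_⟩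
      have h1 : D.f i 1 ∈ V := connectedComponentIn_subset V a (by
        change D.f i 1 ∈ C
        rw [hu]
        trivial)
      rw [hV, Set.mem_ofPred_eq, D.norm_gt_iff h i (mem_annulus_of_norm_eq_one hR norm_one)] at h1
      simp at h1
    have hxc := frontier_subset_closure hx
    have hxL : x ∈ D.f i '' sphere 0 1 := by
      rw [← hL]
      refine le_antisymm (not_lt.mp (frontier_connectedComponentIn_subset hVo a hx)) ?_
      have : IsClosed {z | ‖q.eval z‖ ≤ ‖p.eval z‖} :=
        isClosed_le q.continuous.norm p.continuous.norm
      exact this.closure_subset_iff.mpr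
        ((connectedComponentIn_subset V a).trans fun z hz =>
          le_of_lt (show ‖q.eval z‖ < ‖p.eval z‖ from hz)) hxc
    obtain ⟨w, hw, rfl⟩ := hxL
    have hwA := sphere_subset_annulus hR hw
    have hn : D.f i '' annulus D.R ∈ 𝓝 (D.f i w) := by
      rw [← D.map_nhds_eq h i hwA]
      exact image_mem_map ((isOpen_annulus _).mem_nhds hwA)
    obtain ⟨_, ⟨v, hv, rfl⟩, hvC⟩ := mem_closure_iff_nhds.mp hxc _ hn
    have hvV : D.f i v ∈ V := connectedComponentIn_subset V a hvC
    have hvO : D.f i v ∈ O := ⟨v, ⟨(D.norm_gt_iff h i hv).mp hvV, hv.2⟩, rfl⟩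
    rw [show C = connectedComponentIn V (D.f i v) from connectedComponentIn_eq hvC]
    exact hOpre.subset_connectedComponentIn hvO hOV
  have hOne : O.Nonempty := by
    have e : ‖(((D.R + 1) / 2 : ℝ) : ℂ)‖ = (D.R + 1) / 2 := by
      rw [Complex.norm_real, Real.norm_of_nonneg (by linarith)]
    exact ⟨_, (((D.R + 1) / 2 : ℝ) : ℂ), ⟨by rw [e]; linarith, by rw [e]; linarith⟩, rfl⟩
  obtain ⟨o, ho⟩ := hOne
  have : V = connectedComponentIn V o := by
    refine Set.Subset.antisymm (fun a ha => ?_) (connectedComponentIn_subset _ _)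
    rw [← connectedComponentIn_eq (key a ha ho)]
    exact mem_connectedComponentIn ha
  rw [this]
  exact isPreconnected_connectedComponentIn

end Decomposition

/-- The component of `a` off the lemniscate cannot pass from `|p| < |q|` to `|q| < |p|`, and the
former set is bounded. -/
theorem coe_mem_inside {p q : ℂ[X]}
    (hinf : ∀ᶠ z in Bornology.cobounded ℂ, ‖q.eval z‖ < ‖p.eval z‖) {a : ℂ}
    (ha : ‖p.eval a‖ < ‖q.eval a‖) : a ∈ inside {z | ‖p.eval z‖ = ‖q.eval z‖} := by
  have haL : a ∈ {z | ‖p.eval z‖ = ‖q.eval z‖}ᶜ := ha.ne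
  refine ⟨haL, (Decomposition.isBounded_norm_lt hinf).subset ?_⟩
  refine isPreconnected_connectedComponentIn.subset_left_of_subset_union (isOpen_norm_lt p q)
    (isOpen_norm_lt q p) ?_ ?_ ⟨a, mem_connectedComponentIn haL, ha⟩
  · rw [Set.disjoint_left]
    exact fun z h1 h2 => lt_asymm (show ‖p.eval z‖ < ‖q.eval z‖ from h1)
      (show ‖q.eval z‖ < ‖p.eval z‖ from h2)
  · intro z hz
    exact lt_or_gt_of_ne (connectedComponentIn_subset _ _ hz)

/-- Adding the limit point `∞` to the connected set `|q| < |p|` keeps it connected. -/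
theorem coe_mem_outside {p q : ℂ[X]}
    (hinf : ∀ᶠ z in Bornology.cobounded ℂ, ‖q.eval z‖ < ‖p.eval z‖)
    (hV : IsPreconnected {z | ‖q.eval z‖ < ‖p.eval z‖}) {a : ℂ}
    (ha : ‖q.eval a‖ < ‖p.eval a‖) :
    (a : OnePoint ℂ) ∈ outside {z | ‖p.eval z‖ = ‖q.eval z‖} := by
  set V := {z | ‖q.eval z‖ < ‖p.eval z‖}
  set L := {z | ‖p.eval z‖ = ‖q.eval z‖}
  have h1 : IsPreconnected (((↑) : ℂ → OnePoint ℂ) '' V) :=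
    hV.image _ OnePoint.continuous_coe.continuousOn
  have h2 : OnePoint.infty ∈ closure (((↑) : ℂ → OnePoint ℂ) '' V) := by
    have ht : Tendsto ((↑) : ℂ → OnePoint ℂ) (Bornology.cobounded ℂ) (𝓝 OnePoint.infty) := by
      rw [Metric.cobounded_eq_cocompact, ← coclosedCompact_eq_cocompact]
      exact OnePoint.tendsto_coe_infty
    exact mem_closure_of_tendsto ht (hinf.mono fun z hz => ⟨z, hz, rfl⟩)
  have h3 : IsPreconnected (insert OnePoint.infty (((↑) : ℂ → OnePoint ℂ) '' V)) :=
    h1.subset_closure (Set.subset_insert _ _) (Set.insert_subset h2 subset_closure)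
  refine h3.subset_connectedComponentIn (Set.mem_insert _ _) ?_ (Set.mem_insert_of_mem _ ⟨a, ha, rfl⟩)
  rw [Set.insert_subset_iff]
  refine ⟨OnePoint.infty_notMem_image_coe, ?_⟩
  rintro _ ⟨z, hz, rfl⟩ ⟨w, hw, hzw⟩
  rw [OnePoint.coe_injective hzw] at hw
  exact (ne_of_gt hz) hw

/-! ### The two implications -/

section

variable {r : RatFunc ℂ}

theorem unitCircle_subset_closedDisk : unitCircle ⊆ closedDisk :=
  Set.image_mono sphere_subset_closedBall

theorem lemniscate_eq (hinf : toSphere r OnePoint.infty ∈ diskStar) :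
    lemniscate r = ((↑) : ℂ → OnePoint ℂ) '' {z | ‖r.num.eval z‖ = ‖r.denom.eval z‖} := by
  ext z
  induction z using OnePoint.rec with
  | infty =>
    refine ⟨fun hz => absurd (unitCircle_subset_closedDisk hz) hinf, fun hz => ?_⟩
    exact absurd hz OnePoint.infty_notMem_image_coe
  | coe a =>
    rw [OnePoint.coe_injective.mem_set_image]
    exact toSphere_coe_mem_unitCircle_iff r a

variable (hdeg : 1 ≤ degree r) (hinf : toSphere r OnePoint.infty ∈ diskStar)

include hinf in
theorem eventually_norm_lt :
    ∀ᶠ z in Bornology.cobounded ℂ, ‖r.denom.eval z‖ < ‖r.num.eval z‖ := by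
  obtain ⟨ρ, hρ, hev⟩ := exists_eventually_norm_lt hinf
  filter_upwards [hev] with z hz
  exact (le_mul_of_one_le_left (norm_nonneg _) hρ.le).trans_lt hz

include hdeg hinf

theorem num_ne_zero_of_one_le_degree : r.num ≠ 0 := by
  intro h
  rw [degree_eq_natDegree_num hinf, h, natDegree_zero] at hdeg
  omega

theorem criticalValueCount_disk_eq (D : Decomposition r.num r.denom) :
    (criticalValueCount r disk : ℤ) = degree r - Fintype.card D.ι -
      2 * ∑ i, D.ν (RatFunc.isCoprime_num_denom r) i := by
  classical
  rw [criticalValueCount_disk hdeg hinf, degree_eq_natDegree_num hinf,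
    ← D.card_roots_wronskian (RatFunc.isCoprime_num_denom r) (eventually_norm_lt hinf)
      (wronskian_num_denom_ne_zero r hdeg) (num_ne_zero_of_one_le_degree hdeg hinf)
      r.denom_ne_zero]

/-- An analytic lemniscate has the expected distribution of critical values, and the zeros and
poles are separated by the lemniscate itself. -/
theorem criticalValueCount_and_exists_isJordanCurve_of_isAnalyticJordanCurve
    (hL : IsAnalyticJordanCurve {z | ‖r.num.eval z‖ = ‖r.denom.eval z‖}) :
    (criticalValueCount r disk = degree r - 1 ∧ criticalValueCount r diskStar = degree r - 1) ∧
      ∃ Γ : Set ℂ, IsJordanCurve Γ ∧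
        (∀ z, toSphere r z = ((0 : ℂ) : OnePoint ℂ) → z ∈ ((↑) : ℂ → OnePoint ℂ) '' inside Γ) ∧
        (∀ z, toSphere r z = OnePoint.infty → z ∈ outside Γ) ∧
        ∀ z ∈ Γ, toSphere r (z : OnePoint ℂ) ∈ closedDisk := by
  have hcop := RatFunc.isCoprime_num_denom r
  have hev := eventually_norm_lt hinf
  have hW : ∀ z, ‖r.num.eval z‖ = ‖r.denom.eval z‖ → (wronskian r.num r.denom).eval z ≠ 0 :=
    fun z hz => wronskian_ne_zero_of_isAnalyticJordanCurve hcop hL hz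
  obtain ⟨D⟩ := exists_decomposition hcop (exists_eventually_norm_lt hinf)
    (wronskian_num_denom_ne_zero r hdeg) hW
  have hcard := D.card_eq_one_of_isConnected hL.isJordanCurve.isConnected
  have hV := D.isPreconnected_norm_gt hcop hcard
  refine ⟨?_, _, hL.isJordanCurve, fun z hz => ?_, fun z hz => ?_, fun z hz => ?_⟩
  -- With one curve and `ν = 0` the disk count is `k - 1 - 0`; the total `2k - 2`, with nothing on
  -- the lemniscate, gives the other count.
  · have h1 := criticalValueCount_disk_eq hdeg hinf D
    rw [hcard, D.sum_ν_of_card_eq_one hcop hev hcard] at h1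
    have h2 := criticalValueCount_add hdeg hinf
    rw [Multiset.filter_eq_nil.mpr fun a ha hLa => hW a hLa (isRoot_of_mem_roots ha),
      Multiset.card_zero] at h2
    omega
  · induction z using OnePoint.rec with
    | infty =>
      rw [hz] at hinf
      exact absurd ⟨0, by simp, rfl⟩ hinf
    | coe a =>
      rw [toSphere_coe_eq_zero_iff] at hz
      refine ⟨a, coe_mem_inside hev ?_, rfl⟩
      rw [hz, norm_zero]
      exact norm_pos_iff.mpr fun h0 => eval_ne_zero_or_of_isCoprime hcop hz h0
  · induction z using OnePoint.rec with
    | infty => exact mem_connectedComponentIn OnePoint.infty_notMem_image_coe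
    | coe a =>
      rw [toSphere_coe_eq_infty_iff] at hz
      refine coe_mem_outside hev hV ?_
      rw [hz, norm_zero]
      exact norm_pos_iff.mpr fun h0 => eval_ne_zero_or_of_isCoprime hcop h0 hz
  · exact (toSphere_coe_mem_closedDisk_iff r z).mpr (le_of_eq hz)

theorem isAnalyticJordanCurve_of_criticalValueCount {Γ : Set ℂ}
    (hdisk : criticalValueCount r disk = degree r - 1)
    (hstar : criticalValueCount r diskStar = degree r - 1) (hΓ : IsJordanCurve Γ)
    (hzero : ∀ z, toSphere r z = ((0 : ℂ) : OnePoint ℂ) →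
      z ∈ ((↑) : ℂ → OnePoint ℂ) '' inside Γ)
    (hpole : ∀ z, toSphere r z = OnePoint.infty → z ∈ outside Γ)
    (hle : ∀ z ∈ Γ, toSphere r (z : OnePoint ℂ) ∈ closedDisk) :
    IsAnalyticJordanCurve {z | ‖r.num.eval z‖ = ‖r.denom.eval z‖} := by
  have hcop := RatFunc.isCoprime_num_denom r
  have hW0 := wronskian_num_denom_ne_zero r hdeg
  have hW : ∀ z, ‖r.num.eval z‖ = ‖r.denom.eval z‖ → (wronskian r.num r.denom).eval z ≠ 0 := by
    classical
    intro z hz h0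
    -- The two given counts already exhaust the total `2k - 2`.
    have h2 := criticalValueCount_add hdeg hinf
    have h3 := Multiset.card_pos_iff_exists_mem.mpr
      ⟨z, Multiset.mem_filter (p := fun a => ‖r.num.eval a‖ = ‖r.denom.eval a‖) |>.mpr
        ⟨(mem_roots hW0).mpr h0, hz⟩⟩
    rw [hdisk, hstar] at h2
    omega
  obtain ⟨D⟩ := exists_decomposition hcop (exists_eventually_norm_lt hinf) hW0 hW
  have hroot : ∃ z, r.num.eval z = 0 := by
    refine IsAlgClosed.exists_root r.num fun h0 => ?_
    rw [degree_eq_natDegree_num hinf, natDegree_eq_zero_iff_degree_le_zero.mpr h0.le] at hdeg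
    omega
  have hsum := D.sum_ν_of_isJordanCurve hcop (eventually_norm_lt hinf) hΓ
    (fun z hz => OnePoint.coe_injective.mem_set_image.mp
      (hzero z ((toSphere_coe_eq_zero_iff r z).mpr hz)))
    (fun z hz => hpole z ((toSphere_coe_eq_infty_iff r z).mpr hz))
    (fun z hz => (toSphere_coe_mem_closedDisk_iff r z).mp (hle z hz)) hroot
  have h1 := criticalValueCount_disk_eq hdeg hinf D
  rw [hsum, hdisk] at h1
  -- The count reads `k - 1 = k - n - 2 * (1 - n)`.
  have hcard : Fintype.card D.ι = 1 := by omega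
  obtain ⟨i, hi⟩ := Fintype.card_eq_one_iff.mp hcard
  refine ⟨D.f i, annulus D.R, isOpen_annulus _, sphere_subset_annulus D.one_lt,
    D.differentiableOn i, D.injOn i, ?_⟩
  rw [← D.iUnion_eq]
  exact Set.Subset.antisymm (Set.subset_iUnion (fun j => D.f j '' sphere 0 1) i)
    (Set.iUnion_subset fun j => by rw [hi j])

end

end RationalLemniscate

end

theorem mainTheorem7 (r : RatFunc ℂ) (k : ℕ) (hk : 1 ≤ k) (hdeg : RationalLemniscate.degree r = k)
    (hinf : RationalLemniscate.toSphere r OnePoint.infty ∈ RationalLemniscate.diskStar) :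
    (∃ L : Set ℂ, RationalLemniscate.IsAnalyticJordanCurve L ∧
        RationalLemniscate.lemniscate r = ((↑) : ℂ → OnePoint ℂ) '' L) ↔
      ((RationalLemniscate.criticalValueCount r RationalLemniscate.disk = k - 1 ∧
          RationalLemniscate.criticalValueCount r RationalLemniscate.diskStar = k - 1) ∧
        ∃ Γ : Set ℂ, RationalLemniscate.IsJordanCurve Γ ∧
          (∀ z, RationalLemniscate.toSphere r z = ((0 : ℂ) : OnePoint ℂ) →
            z ∈ ((↑) : ℂ → OnePoint ℂ) '' RationalLemniscate.inside Γ) ∧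
          (∀ z, RationalLemniscate.toSphere r z = OnePoint.infty →
            z ∈ RationalLemniscate.outside Γ) ∧
          ∀ z ∈ Γ, RationalLemniscate.toSphere r (z : OnePoint ℂ) ∈
            RationalLemniscate.closedDisk) := by
  subst hdeg
  rw [RationalLemniscate.lemniscate_eq hinf]
  constructor
  · rintro ⟨L, hL, hLr⟩
    rw [← OnePoint.coe_injective.image_injective hLr] at hL
    exact
      RationalLemniscate.criticalValueCount_and_exists_isJordanCurve_of_isAnalyticJordanCurve
        hk hinf hL
  · rintro ⟨⟨h1, h2⟩, Γ, hΓ, hzero, hpole, hle⟩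
    exact ⟨_, RationalLemniscate.isAnalyticJordanCurve_of_criticalValueCount hk hinf h1 h2 hΓ
      hzero hpole hle, rfl⟩
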